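/- Let $K$ be a finite abstract simplicial complex on a finite set $V$, that is, a set of subsets of $V$ (the faces) that is closed under taking subsets and contains $\emptyset$. Let $\mathbb{F}$ be a field, and let $$\mathbb{F}(K)=\mathbb{F}[v_j : j\in V]\big/\Big(\prod_{j\in\sigma}v_j \;:\; \sigma\subset V,\ \sigma\notin K\Big)$$ be its face ring (Stanley–Reisner algebra), graded so that every generator $v_j$ has degree $2$. For a face $\tau\in K$ let $\operatorname{link}_K(\tau)=\{\sigma\setminus\tau : \tau\subset\sigma\in K\}$. Call $K$ pure if all its maximal faces have the same number of elements. Let $A$ be a non-negatively graded commutative $\mathbb{F}$-algebra. A homogeneous system of parameters (hsop) of $A$ is a finite sequence $a_1,\dots,a_r$ of homogeneous, algebraically independent elements such that $A/(a_1,\dots,a_r)$ vanishes in large degrees and is finite dimensional over $\mathbb{F}$ in each degree. $A$ is Cohen–Macaulay if it has an hsop $a_1,\dots,a_r$ that is a regular sequence, i.e. $a_{i+1}$ is not a zero divisor in $A/(a_1,\dots,a_i)$ for $0\le i<r$. $A$ is Gorenstein if it is Cohen–Macaulay and, for every hsop $a_1,\dots,a_r$ of $A$, the socle $\{b\in B :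 B^{+}b=0\}$ of $B=A/(a_1,\dots,a_r)$ is isomorphic to $\mathbb{F}$ as an $\mathbb{F}$-vector space, where $B^{+}$ denotes the elements of positive degree. Then: 1. If $\mathbb{F}(K)$ is Cohen–Macaulay, then $K$ is pure and, for every face $\tau\in K$ (including $\tau=\emptyset$), $\mathbb{F}(\operatorname{link}_K(\tau))$ is Cohen–Macaulay. 2. If $\mathbb{F}(K)$ is Gorenstein, then $K$ is pure and, for every face $\tau\in K$ (including $\tau=\emptyset$), $\mathbb{F}(\operatorname{link}_K(\tau))$ is Gorenstein. -/

import Mathlib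

/-! ### Simplicial complexes

Mathlib's `PreAbstractSimplicialComplex V` records the nonempty faces only; the empty set is
counted as a face as well by `IsFace`. Elements of `V` that are not vertices of the complex are
allowed, so that the link of a face is a complex over the same `V`. -/

namespace PreAbstractSimplicialComplex

/-- The faces of `K`, including the empty face. -/
def IsFace {V : Type*} (K : PreAbstractSimplicialComplex V) (σ : Finset V) : Prop :=
  σ = ∅ ∨ σ ∈ K

/-- All maximal faces have the same dimension. -/
def IsPure {V : Type*} (K : PreAbstractSimplicialComplex V) : Prop :=
  ∀ σ τ : Finset V, Maximal K.IsFace σ → Maximal K.IsFace τ → σ.card = τ.card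

/-- The link `{τ \ σ : σ ⊆ τ ∈ K}` of a face `σ`. -/
def link {V : Type*} [DecidableEq V] (K : PreAbstractSimplicialComplex V) (σ : Finset V) :
    PreAbstractSimplicialComplex V where
  faces := {ρ | ρ.Nonempty ∧ ∃ τ : Finset V, K.IsFace τ ∧ σ ⊆ τ ∧ ρ = τ \ σ}
  isRelLowerSet_faces := by
    rintro ρ ⟨hρ, τ, hτ, hστ, rfl⟩
    refine ⟨hρ, fun t ht htne => ⟨htne, σ ∪ t, ?_, Finset.subset_union_left, ?_⟩⟩
    · have hsub : σ ∪ t ⊆ τ := Finset.union_subset hστ (ht.trans Finset.sdiff_subset)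
      rcases hτ with rfl | hτ
      · exact Or.inl (Finset.subset_empty.mp hsub)
      · exact Or.inr ((K.isRelLowerSet_faces hτ).2 hsub
          (htne.mono Finset.subset_union_right))
    · ext x
      have := @ht x
      simp only [Finset.mem_sdiff, Finset.mem_union] at this ⊢
      tauto

end PreAbstractSimplicialComplex

/-! ### Graded algebras

`𝒜 : ℕ → Submodule F A` is the family of graded pieces of a non-negatively graded commutative
`F`-algebra `A`. -/

namespace GradedPieces

variable {F A : Type*} [Field F] [CommRing A] [Algebra F A]

/-- The induced family of graded pieces on the quotient by an ideal. -/
def quotient (𝒜 : ℕ → Submodule F A) (I : Ideal A) : ℕ → Submodule F (A ⧸ I) :=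
  fun j => (𝒜 j).map (Ideal.Quotient.mkₐ F I).toLinearMap

/-- The graded pieces vanish in large degrees, and all of them are finite dimensional. -/
def IsFFinite (𝒜 : ℕ → Submodule F A) : Prop :=
  (∃ N : ℕ, ∀ j : ℕ, N ≤ j → 𝒜 j = ⊥) ∧ ∀ j : ℕ, Module.Finite F (𝒜 j)

/-- Homogeneous systems of parameters. -/
structure IsHsop (𝒜 : ℕ → Submodule F A) {r : ℕ} (a : Fin r → A) : Prop where
  homogeneous : ∀ i, SetLike.IsHomogeneousElem 𝒜 (a i)
  algebraicIndependent : AlgebraicIndependent F a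
  finite_quotient : IsFFinite (quotient 𝒜 (Ideal.span (Set.range a)))

/-- There is a homogeneous system of parameters `a₁, …, aᵣ` such that each `aᵢ₊₁` is a
non-zero-divisor on `A / (a₁, …, aᵢ)`. -/
def IsCohenMacaulay (𝒜 : ℕ → Submodule F A) : Prop :=
  ∃ (r : ℕ) (a : Fin r → A),
    IsHsop 𝒜 a ∧ RingTheory.Sequence.IsWeaklyRegular A (List.ofFn a)

/-- The socle: the elements annihilated by all elements of positive degree. -/
def socle (𝒜 : ℕ → Submodule F A) : Submodule F A where
  carrier := {b | ∀ j : ℕ, 0 < j → ∀ c ∈ 𝒜 j, c * b = 0}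
  add_mem' := fun hb hb' j hj c hc => by rw [mul_add, hb j hj c hc, hb' j hj c hc, add_zero]
  zero_mem' := fun _ _ _ _ => mul_zero _
  smul_mem' := fun t b hb j hj c hc => by rw [mul_smul_comm, hb j hj c hc, smul_zero]

/-- Cohen-Macaulay, and the socle of the quotient by any homogeneous system of parameters is
one-dimensional. -/
def IsGorenstein (𝒜 : ℕ → Submodule F A) : Prop :=
  IsCohenMacaulay 𝒜 ∧ ∀ (r : ℕ) (a : Fin r → A), IsHsop 𝒜 a →
    Nonempty (socle (quotient 𝒜 (Ideal.span (Set.range a))) ≃ₗ[F] F)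

end GradedPieces

/-! ### The face ring -/

namespace PreAbstractSimplicialComplex

/-- The ideal generated by the monomials `∏ j ∈ σ, v_j` for the non-faces `σ`. -/
noncomputable def stanleyReisnerIdeal {V : Type*} (K : PreAbstractSimplicialComplex V)
    (F : Type*) [Field F] : Ideal (MvPolynomial V F) :=
  Ideal.span {f | ∃ σ : Finset V, ¬ K.IsFace σ ∧ f = ∏ j ∈ σ, MvPolynomial.X j}

/-- The face ring (Stanley-Reisner algebra) `F(K)`. -/
abbrev FaceRing {V : Type*} (K : PreAbstractSimplicialComplex V) (F : Type*) [Field F] : Type _ :=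
  MvPolynomial V F ⧸ K.stanleyReisnerIdeal F

/-- The grading of the face ring in which all generators have degree `2`. -/
noncomputable def faceRingGrading {V : Type*} (K : PreAbstractSimplicialComplex V)
    (F : Type*) [Field F] : ℕ → Submodule F (K.FaceRing F) :=
  GradedPieces.quotient (MvPolynomial.weightedHomogeneousSubmodule F (fun _ : V => 2))
    (K.stanleyReisnerIdeal F)

end PreAbstractSimplicialComplex

/-!
Let `v` be a vertex and let `S` be the closed star of `v`. A polynomial `p` lies in the ideal of
`S` if and only if `v * p` lies in the ideal of `K`, and the ideal of the link of `v` is that of `S`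
plus `(v)`. Squaring the variable `v` maps a homogeneous system of parameters `l` of `F(K)` to
another one, `l'`. Over its image under the squaring map, the polynomial ring is free with basis
`1, v`, and the two components of `F(K) / (l')` are `F(K) / (l)` and `F(S) / (l)`. Hence `l` is
regular on `F(S)` if `l'` is regular on `F(K)`, and comparing socles shows that `F(S) / (l)` has a
simple socle if both `F(K) / (l)` and `F(K) / (l')` have one.

After localization at the irrelevant ideal, one system of parameters is turned into another by
replacing one element at a time, where prime avoidance supplies the intermediate elements. Hence
regularity and the simple socle do not depend on the system. Applied to `F(S)` this passes from `l`
to `v, b` for a system of parameters `b` of the link, and dividing by `v` gives both properties for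
the link. Such `b` exist: the elementary symmetric polynomials of degree at most the maximal size
of a face form one.

Faces of larger size follow by adding one vertex at a time. A regular system of parameters of `K`
is one longer than those of the link of each vertex, so by induction its length is the size of
every maximal face, which is purity.
-/

namespace StanleyReisner

open Ideal IsLocalRing RingTheory.Sequence

section Quotient

variable {R : Type*} [CommRing R] {I J : Ideal R} {a b z : R} {l l' : List R}

theorem mem_sup_span_singleton : z ∈ I ⊔ span {a} ↔ ∃ y, z - a * y ∈ I := by
  simp only [sup_comm I, mem_span_singleton_sup, mul_comm _ a]
  constructor
  · rintro ⟨y, i, hi, rfl⟩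
    exact ⟨y, by simpa using hi⟩
  · rintro ⟨y, hy⟩
    exact ⟨y, _, hy, by ring⟩

theorem sup_span_singleton_congr (h : a - b ∈ I) : I ⊔ span {a} = I ⊔ span {b} := by
  suffices key : ∀ {a b : R}, a - b ∈ I → I ⊔ span {a} ≤ I ⊔ span {b} from
    le_antisymm (key h) (key (by simpa using I.neg_mem h))
  intro a b h
  refine sup_le le_sup_left ((span_singleton_le_iff_mem _).2 ?_)
  exact mem_sup_span_singleton.2 ⟨1, by simpa using h⟩

theorem isSMulRegular_quotient_iff : IsSMulRegular (R ⧸ I) a ↔ ∀ z, a * z ∈ I → z ∈ I :=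
  isSMulRegular_quotient_iff_mem_of_smul_mem I a

theorem isSMulRegular_quotient_congr (h : a - b ∈ I) :
    IsSMulRegular (R ⧸ I) a ↔ IsSMulRegular (R ⧸ I) b := by
  simp only [IsSMulRegular, Algebra.smul_def, Quotient.algebraMap_eq, Ideal.Quotient.eq.2 h]

/-- The third isomorphism theorem `(R/I)/J(R/I) ≅ R/(I + J)`, with the submodule written in the
form in which regular sequences produce it. -/
noncomputable def quotientSMulTopEquiv (I J : Ideal R) :
    ((R ⧸ I) ⧸ (J • ⊤ : Submodule R (R ⧸ I))) ≃ₗ[R] R ⧸ (I ⊔ J) :=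
  (Submodule.quotEquivOfEq _ _ (by
    rw [← I.range_mkQ, ← Submodule.map_top, ← Submodule.map_smul'', smul_eq_mul, mul_top])).trans
    (Submodule.quotientQuotientEquivQuotientSup I J)

theorem isWeaklyRegular_quotient_append_iff :
    IsWeaklyRegular (R ⧸ I) (l ++ l') ↔
      IsWeaklyRegular (R ⧸ I) l ∧ IsWeaklyRegular (R ⧸ (I ⊔ ofList l)) l' := by
  rw [isWeaklyRegular_append_iff, (quotientSMulTopEquiv I (ofList l)).isWeaklyRegular_congr]

theorem isWeaklyRegular_quotient_cons_iff :
    IsWeaklyRegular (R ⧸ I) (a :: l) ↔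
      IsSMulRegular (R ⧸ I) a ∧ IsWeaklyRegular (R ⧸ (I ⊔ span {a})) l := by
  rw [← List.singleton_append, isWeaklyRegular_quotient_append_iff,
    isWeaklyRegular_singleton_iff, ofList_singleton]

theorem isWeaklyRegular_quotient_cons_iff_of_mem_maximalIdeal [IsLocalRing R] [IsNoetherianRing R]
    (ha : a ∈ maximalIdeal R) (hl : ∀ x ∈ l, x ∈ maximalIdeal R) :
    IsWeaklyRegular (R ⧸ I) (a :: l) ↔
      IsWeaklyRegular (R ⧸ I) l ∧ IsSMulRegular (R ⧸ (I ⊔ ofList l)) a := by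
  have hperm := List.perm_append_singleton a l
  have hm : ∀ x ∈ a :: l, x ∈ maximalIdeal R := List.forall_mem_cons.2 ⟨ha, hl⟩
  rw [← isWeaklyRegular_singleton_iff, ← isWeaklyRegular_quotient_append_iff]
  exact ⟨fun h => isWeaklyRegular_of_perm_of_subset_maximalIdeal h hperm.symm hm,
    fun h => isWeaklyRegular_of_perm_of_subset_maximalIdeal h hperm
      fun x hx => hm x (hperm.mem_iff.1 hx)⟩

/-- Prime avoidance for the coset `b + J`. -/
theorem exists_forall_add_notMem {s : Finset (Ideal R)}
    (hs : ∀ p ∈ s, p.IsPrime) (h : ∀ p ∈ s, ¬ J ⊔ span {b} ≤ p) :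
    ∃ y ∈ J, ∀ p ∈ s, b + y ∉ p := by
  classical
  let T := {p ∈ s | b ∈ p}
  let U := {p ∈ s | Maximal (· ∈ s) p ∧ b ∉ p}
  obtain ⟨y, ⟨hyJ, hyU⟩, hyT⟩ : ∃ y ∈ J ⊓ U.inf id, ∀ p ∈ T, y ∉ p := by
    by_contra! hcon
    obtain ⟨p, hp, hle⟩ := (subset_union_prime (s := T) (f := id) ⊥ ⊥
      fun p hp _ _ => hs p (Finset.mem_filter.1 hp).1).1
        fun y hy => by simpa using hcon y hy
    obtain ⟨hps, hbp⟩ := Finset.mem_filter.1 hp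
    obtain hJp | ⟨q, hq, hqp⟩ := ((hs p hps).inf_le.1 hle).imp_right (hs p hps).inf_le'.1
    · exact h p hps (sup_le hJp ((span_singleton_le_iff_mem _).2 hbp))
    · obtain ⟨-, hqmax, hbq⟩ := Finset.mem_filter.1 hq
      exact hbq (hqmax.eq_of_le hps hqp ▸ hbp)
  refine ⟨y, hyJ, fun p hp hmem => ?_⟩
  obtain ⟨m, hpm, hm⟩ := s.exists_le_maximal hp
  by_cases hbm : b ∈ m
  · exact hyT m (Finset.mem_filter.2 ⟨hm.1, hbm⟩) ((m.add_mem_iff_right hbm).1 (hpm hmem))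
  · have hym : y ∈ m := Finset.inf_le (f := id) (Finset.mem_filter.2 ⟨hm.1, hm, hbm⟩ : m ∈ U) hyU
    exact hbm ((m.add_mem_iff_left hym).1 (hpm hmem))

theorem exists_isSMulRegular_quotient_add [IsNoetherianRing R] {J' : Ideal R}
    (ha : IsSMulRegular (R ⧸ J) a) (hab : a ∈ (J ⊔ (J' ⊔ span {b})).radical) :
    ∃ y ∈ J', IsSMulRegular (R ⧸ J) (b + y) := by
  have hfin := associatedPrimes.finite R (R ⧸ J)
  have hreg : ∀ {x : R}, IsSMulRegular (R ⧸ J) x ↔ ∀ p ∈ associatedPrimes R (R ⧸ J), x ∉ p := by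
    intro x
    simpa using (Set.ext_iff.1 (biUnion_associatedPrimes_eq_compl_regular R (R ⧸ J)) x).not.symm
  obtain ⟨y, hy, hyp⟩ := exists_forall_add_notMem (J := J') (b := b) (s := hfin.toFinset)
    (fun p hp => (hfin.mem_toFinset.1 hp).1) fun p hp hle => by
      have hp' := hfin.mem_toFinset.1 hp
      have hJp : J ≤ p := by
        simpa [Submodule.annihilator_top, annihilator_quotient] using
          IsAssociatedPrime.annihilator_le hp'
      exact hreg.1 ha p hp' (hp'.1.radical_le_iff.2 (sup_le hJp hle) hab)
  exact ⟨y, hy, hreg.2 fun p hp => hyp p (hfin.mem_toFinset.2 hp)⟩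

end Quotient

section Socle

variable {R : Type*} [CommRing R] {𝔪 J : Ideal R} {a c u w z : R}

/-- The socle `(J : 𝔪) / J` of `R / J` is generated by one nonzero element. -/
def HasSimpleSocle (𝔪 J : Ideal R) : Prop :=
  ∃ u ∈ J.colon (𝔪 : Set R), u ∉ J ∧ ∀ z ∈ J.colon (𝔪 : Set R), ∃ k, z - k * u ∈ J

theorem exists_mem_colon_of_mul_sub_mul_mem (ha : IsSMulRegular (R ⧸ J) a) (hc : c ∈ 𝔪)
    (hu : u ∈ (J ⊔ span {a}).colon (𝔪 : Set R)) :
    ∃ w ∈ (J ⊔ span {c}).colon (𝔪 : Set R), c * u - a * w ∈ J := by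
  rw [Submodule.mem_colon] at hu
  obtain ⟨w, hw⟩ := mem_sup_span_singleton.1 (hu c hc)
  simp only [smul_eq_mul, mul_comm u] at hw hu
  refine ⟨w, Submodule.mem_colon.2 fun x hx => ?_, hw⟩
  obtain ⟨y, hy⟩ := mem_sup_span_singleton.1 (hu x hx)
  refine mem_sup_span_singleton.2 ⟨y, isSMulRegular_quotient_iff.1 ha _ ?_⟩
  convert J.sub_mem (J.mul_mem_left c hy) (J.mul_mem_left x hw) using 1
  rw [smul_eq_mul]
  ring

theorem mem_sup_span_of_mul_sub_mul_mem (hc : IsSMulRegular (R ⧸ J) c)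
    (h : c * u - a * w ∈ J) (hw : w ∈ J ⊔ span {c}) : u ∈ J ⊔ span {a} := by
  obtain ⟨y, hy⟩ := mem_sup_span_singleton.1 hw
  refine mem_sup_span_singleton.2 ⟨y, isSMulRegular_quotient_iff.1 hc _ ?_⟩
  convert J.add_mem h (J.mul_mem_left a hy) using 1
  ring

theorem colon_le_of_exchange (ha : IsSMulRegular (R ⧸ J) a) (hc : IsSMulRegular (R ⧸ J) c)
    (ham : a ∈ 𝔪)
    (h : (J ⊔ span {a}).colon (𝔪 : Set R) ≤ J ⊔ span {a}) :
    (J ⊔ span {c}).colon (𝔪 : Set R) ≤ J ⊔ span {c} := fun z hz => by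
  obtain ⟨w, hw, hzw⟩ := exists_mem_colon_of_mul_sub_mul_mem hc ham hz
  exact mem_sup_span_of_mul_sub_mul_mem ha hzw (h hw)

theorem HasSimpleSocle.exchange (ha : IsSMulRegular (R ⧸ J) a) (hc : IsSMulRegular (R ⧸ J) c)
    (ham : a ∈ 𝔪) (hcm : c ∈ 𝔪) (h : HasSimpleSocle 𝔪 (J ⊔ span {a})) :
    HasSimpleSocle 𝔪 (J ⊔ span {c}) := by
  obtain ⟨u, hmu, hu, hgen⟩ := h
  obtain ⟨w, hmw, huw⟩ := exists_mem_colon_of_mul_sub_mul_mem ha hcm hmu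
  refine ⟨w, hmw, fun hw => hu (mem_sup_span_of_mul_sub_mul_mem hc huw hw), fun z hz => ?_⟩
  obtain ⟨z', hmz', hzz'⟩ := exists_mem_colon_of_mul_sub_mul_mem hc ham hz
  obtain ⟨k, hk⟩ := hgen z' hmz'
  refine ⟨k, mem_sup_span_of_mul_sub_mul_mem (w := z' - k * u) ha ?_ hk⟩
  convert J.add_mem hzz' (J.mul_mem_left k huw) using 1
  ring

end Socle

section Exchange

variable {R : Type*} [CommRing R] [IsLocalRing R] [IsNoetherianRing R] {I : Ideal R}
  {as bs : List R}

/-- A regular sequence is turned into another sequence that generates it up to radical by replacing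
one element at a time. A property of ideals that survives the replacement of the last element of a
regular sequence is therefore shared by the ideals of the two sequences. -/
theorem isWeaklyRegular_and_of_exchange {P : Ideal R → Prop}
    (hP : ∀ (J : Ideal R) (a c : R), a ∈ maximalIdeal R → c ∈ maximalIdeal R →
      IsSMulRegular (R ⧸ J) a → IsSMulRegular (R ⧸ J) c → P (J ⊔ span {a}) → P (J ⊔ span {c}))
    (hlen : as.length = bs.length) (ham : ∀ a ∈ as, a ∈ maximalIdeal R)
    (hbm : ∀ b ∈ bs, b ∈ maximalIdeal R) (hreg : IsWeaklyRegular (R ⧸ I) as)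
    (hrad : ∀ a ∈ as, a ∈ (I ⊔ ofList bs).radical) :
    IsWeaklyRegular (R ⧸ I) bs ∧ (P (I ⊔ ofList as) → P (I ⊔ ofList bs)) := by
  induction as generalizing I bs with
  | nil =>
    obtain rfl := List.length_eq_zero_iff.1 hlen.symm
    exact ⟨.nil .., id⟩
  | cons a as ih =>
    obtain ⟨b, bs, rfl⟩ := List.exists_cons_of_length_eq_add_one hlen.symm
    obtain ⟨ha, ham⟩ := List.forall_mem_cons.1 ham
    obtain ⟨hb, hbm⟩ := List.forall_mem_cons.1 hbm
    obtain ⟨harad, hrad⟩ := List.forall_mem_cons.1 hrad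
    obtain ⟨has, hareg⟩ := (isWeaklyRegular_quotient_cons_iff_of_mem_maximalIdeal ha ham).1 hreg
    obtain ⟨y, hy, hcreg⟩ := exists_isSMulRegular_quotient_add (J' := ofList bs) (b := b) hareg <|
      radical_mono (by rw [ofList_cons, sup_comm (span {b})]; exact sup_le_sup_right le_sup_left _)
        harad
    have hc : b + y ∈ maximalIdeal R := add_mem hb (span_le.2 hbm hy)
    have hcb : I ⊔ span {b + y} ⊔ ofList bs = I ⊔ ofList (b :: bs) := by
      rw [sup_assoc, sup_comm (span _), sup_span_singleton_congr (b := b) (by simpa using hy),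
        ofList_cons, sup_comm (span {b})]
    obtain ⟨hcreg', hcas⟩ := isWeaklyRegular_quotient_cons_iff.1 <|
      (isWeaklyRegular_quotient_cons_iff_of_mem_maximalIdeal hc ham).2 ⟨has, hcreg⟩
    obtain ⟨hcbs, hPcb⟩ := ih (by simpa using hlen) ham hbm hcas (by rwa [hcb])
    obtain ⟨hbs, hcbs'⟩ := (isWeaklyRegular_quotient_cons_iff_of_mem_maximalIdeal hc hbm).1 <|
      isWeaklyRegular_quotient_cons_iff.2 ⟨hcreg', hcbs⟩
    refine ⟨(isWeaklyRegular_quotient_cons_iff_of_mem_maximalIdeal hb hbm).2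
      ⟨hbs, (isSMulRegular_quotient_congr ?_).1 hcbs'⟩, fun h => hcb ▸ hPcb ?_⟩
    · simpa using mem_sup_right hy
    · rw [sup_right_comm]
      refine hP _ _ _ ha hc hareg hcreg ?_
      rwa [sup_assoc, sup_comm (ofList as), ← ofList_cons]

theorem isWeaklyRegular_of_forall_mem_radical
    (hlen : as.length = bs.length) (ham : ∀ a ∈ as, a ∈ maximalIdeal R)
    (hbm : ∀ b ∈ bs, b ∈ maximalIdeal R) (hreg : IsWeaklyRegular (R ⧸ I) as)
    (hrad : ∀ a ∈ as, a ∈ (I ⊔ ofList bs).radical) : IsWeaklyRegular (R ⧸ I) bs :=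
  (isWeaklyRegular_and_of_exchange (P := fun _ => True) (fun _ _ _ _ _ _ _ => id)
    hlen ham hbm hreg hrad).1

theorem HasSimpleSocle.of_forall_mem_radical
    (hlen : as.length = bs.length) (ham : ∀ a ∈ as, a ∈ maximalIdeal R)
    (hbm : ∀ b ∈ bs, b ∈ maximalIdeal R) (hreg : IsWeaklyRegular (R ⧸ I) as)
    (hrad : ∀ a ∈ as, a ∈ (I ⊔ ofList bs).radical)
    (h : HasSimpleSocle (maximalIdeal R) (I ⊔ ofList as)) :
    HasSimpleSocle (maximalIdeal R) (I ⊔ ofList bs) :=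
  (isWeaklyRegular_and_of_exchange (fun _ _ _ ha hc har hcr => .exchange har hcr ha hc)
    hlen ham hbm hreg hrad).2 h

theorem length_le_of_forall_mem_radical
    (ham : ∀ a ∈ as, a ∈ maximalIdeal R) (hbm : ∀ b ∈ bs, b ∈ maximalIdeal R)
    (hreg : IsWeaklyRegular (R ⧸ I) as) (hrad : ∀ a ∈ as, a ∈ (I ⊔ ofList bs).radical)
    (hsoc : ¬ (I ⊔ ofList bs).colon (maximalIdeal R : Set R) ≤ I ⊔ ofList bs) :
    as.length ≤ bs.length := by
  by_contra! hlt
  have hmem : ∀ a ∈ as.take bs.length, a ∈ as := fun a ha => List.mem_of_mem_take ha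
  rw [← List.take_append_drop bs.length as, isWeaklyRegular_quotient_append_iff,
    List.drop_eq_getElem_cons hlt, isWeaklyRegular_quotient_cons_iff] at hreg
  refine hsoc ((isWeaklyRegular_and_of_exchange
    (P := fun J => J.colon (maximalIdeal R : Set R) ≤ J)
    (fun _ _ _ ha _ har hcr => colon_le_of_exchange har hcr ha) (by simp; omega)
    (fun a ha => ham a (hmem a ha)) hbm hreg.1 fun a ha => hrad a (hmem a ha)).2 fun u hu => ?_)
  refine isSMulRegular_quotient_iff.1 hreg.2.1 u ?_
  rw [mul_comm]
  exact Submodule.mem_colon.1 hu _ (ham _ (List.getElem_mem hlt))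

end Exchange

section Saturation

variable {R : Type*} [CommRing R] {𝔪 I J : Ideal R} {a p s u z : R} {l : List R}

theorem HasSimpleSocle.map_iff {S : Type*} [CommRing S] {f : R →+* S} {J : Ideal S}
    (hf : ∀ z, ∃ p, z - f p ∈ J) :
    HasSimpleSocle (𝔪.map f) J ↔ HasSimpleSocle 𝔪 (J.comap f) := by
  have hcolon : ∀ {z p}, z - f p ∈ J →
      (z ∈ J.colon (𝔪.map f : Set S) ↔ p ∈ (J.comap f).colon (𝔪 : Set R)) := by
    intro z p hzp
    rw [map, Ideal.colon_span, Submodule.mem_colon, Submodule.mem_colon, Set.forall_mem_image]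
    refine forall₂_congr fun x _ => ?_
    rw [smul_eq_mul, smul_eq_mul, mem_comap, map_mul, ← sub_add_cancel z (f p), add_mul,
      J.add_mem_iff_right (J.mul_mem_right _ hzp)]
  constructor
  · rintro ⟨u, hmu, hu, hgen⟩
    obtain ⟨p, hp⟩ := hf u
    refine ⟨p, (hcolon hp).1 hmu, fun h => hu ((J.sub_mem_iff_left h).1 hp), fun q hq => ?_⟩
    obtain ⟨k, hk⟩ := hgen (f q) ((hcolon (by simp)).2 hq)
    obtain ⟨r, hr⟩ := hf k
    refine ⟨r, ?_⟩
    rw [mem_comap]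
    convert J.add_mem hk (J.add_mem (J.mul_mem_right u hr) (J.mul_mem_left (f r) hp)) using 1
    rw [map_sub, map_mul]
    ring
  · rintro ⟨p, hmp, hp, hgen⟩
    refine ⟨f p, (hcolon (by simp)).2 hmp, hp, fun z hz => ?_⟩
    obtain ⟨q, hq⟩ := hf z
    obtain ⟨k, hk⟩ := hgen q ((hcolon hq).1 hz)
    refine ⟨f k, ?_⟩
    convert J.add_mem hq (mem_comap.1 hk) using 1
    rw [map_sub, map_mul]
    ring

theorem HasSimpleSocle.exists_sub_mul_mem [h𝔪 : 𝔪.IsMaximal] (h : HasSimpleSocle 𝔪 J)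
    (hmu : u ∈ J.colon (𝔪 : Set R)) (hu : u ∉ J) (hz : z ∈ J.colon (𝔪 : Set R)) :
    ∃ k, z - k * u ∈ J := by
  obtain ⟨g, hmg, -, hgen⟩ := h
  obtain ⟨i, hi⟩ := hgen u hmu
  obtain ⟨k, hk⟩ := hgen z hz
  have him : i ∉ 𝔪 := fun him => hu <| by
    have hig := Submodule.mem_colon.1 hmg i him
    rw [smul_eq_mul, mul_comm] at hig
    simpa using J.add_mem hi hig
  obtain ⟨j, x, hx, hjx⟩ := h𝔪.exists_inv him
  have hgu : g - j * u ∈ J := by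
    convert J.sub_mem (Submodule.mem_colon.1 hmg x hx) (J.mul_mem_left j hi) using 1
    rw [smul_eq_mul]
    linear_combination -g * hjx
  refine ⟨k * j, ?_⟩
  convert J.add_mem hk (J.mul_mem_left k hgu) using 1
  ring

theorem HasSimpleSocle.of_mul [𝔪.IsMaximal] {A B : Ideal R} (h : HasSimpleSocle 𝔪 A)
    (hmul : ∀ b ∈ B, a * b ∈ A) (hinj : ∀ b ∈ B.colon (𝔪 : Set R), a * b ∈ A → b ∈ B)
    (hB : ∃ s ∈ B.colon (𝔪 : Set R), s ∉ B) : HasSimpleSocle 𝔪 B := by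
  have hcolon : ∀ b ∈ B.colon (𝔪 : Set R), a * b ∈ A.colon (𝔪 : Set R) := fun b hb =>
    Submodule.mem_colon.2 fun x hx => by
      simpa only [smul_eq_mul, mul_assoc] using hmul _ (Submodule.mem_colon.1 hb x hx)
  obtain ⟨s, hms, hs⟩ := hB
  refine ⟨s, hms, hs, fun z hz => ?_⟩
  obtain ⟨k, hk⟩ := h.exists_sub_mul_mem (hcolon s hms) (fun h => hs (hinj s hms h)) (hcolon z hz)
  refine ⟨k, hinj _ (Submodule.sub_mem _ hz (mul_mem_left _ k hms)) ?_⟩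
  convert hk using 1
  ring

theorem exists_mem_colon_notMem (hfg : 𝔪.FG) (hrad : 𝔪 ≤ J.radical) {H : Ideal R}
    (hH : ¬ H ≤ J) : ∃ u ∈ H, u ∈ J.colon (𝔪 : Set R) ∧ u ∉ J := by
  classical
  have hex : ∃ N, 𝔪 ^ N * H ≤ J := by
    obtain ⟨N, hN⟩ := exists_pow_le_of_le_radical_of_fg hrad hfg
    exact ⟨N, mul_le_left.trans hN⟩
  obtain ⟨N, hN⟩ : ∃ N, Nat.find hex = N + 1 := by
    refine Nat.exists_eq_succ_of_ne_zero fun h0 => hH ?_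
    simpa only [h0, pow_zero, one_eq_top, top_mul] using Nat.find_spec hex
  obtain ⟨u, hu, huJ⟩ := SetLike.not_le_iff_exists.1 (Nat.find_min hex (m := N) (by omega))
  refine ⟨u, mul_le_right hu, Submodule.mem_colon.2 fun x hx => Nat.find_spec hex ?_, huJ⟩
  rw [hN, pow_succ', mul_assoc, smul_eq_mul, mul_comm u]
  exact mul_mem_mul hx hu

/-- The elements outside the prime ideal `𝔪` are nonzerodivisors modulo `J`; equivalently, `J` is
the contraction of its extension to the localization at `𝔪`. -/
def IsSaturatedAt (𝔪 J : Ideal R) : Prop :=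
  ∀ s ∉ 𝔪, IsSMulRegular (R ⧸ J) s

theorem exists_mul_sub_one_mem [h𝔪 : 𝔪.IsMaximal] (hrad : 𝔪 ≤ J.radical) (hs : s ∉ 𝔪) :
    ∃ t, s * t - 1 ∈ J := by
  obtain ⟨y, x, hx, hyx⟩ := h𝔪.exists_inv hs
  obtain ⟨n, hn⟩ := hrad hx
  obtain ⟨k, hk⟩ := one_sub_dvd_one_sub_pow x n
  refine ⟨y * k, ?_⟩
  convert J.neg_mem hn using 1
  linear_combination -hk + k * hyx

theorem isSaturatedAt_of_le_radical [𝔪.IsMaximal] (hrad : 𝔪 ≤ J.radical) :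
    IsSaturatedAt 𝔪 J := fun s hs => isSMulRegular_quotient_iff.2 fun z hz => by
  obtain ⟨t, ht⟩ := exists_mul_sub_one_mem hrad hs
  convert J.sub_mem (J.mul_mem_left t hz) (J.mul_mem_left z ht) using 1
  ring

theorem IsSaturatedAt.comap_map (S : Type*) [CommRing S] [Algebra R S] [𝔪.IsPrime]
    [IsLocalization.AtPrime S 𝔪] (h : IsSaturatedAt 𝔪 J) :
    (J.map (algebraMap R S)).comap (algebraMap R S) = J := by
  refine le_antisymm (fun z hz => ?_) le_comap_map
  obtain ⟨s, hs, hsz⟩ :=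
    (IsLocalization.algebraMap_mem_map_algebraMap_iff 𝔪.primeCompl S J z).1 (mem_comap.1 hz)
  exact isSMulRegular_quotient_iff.1 (h s hs) z hsz

theorem map_sup_ofList {S : Type*} [CommRing S] (f : R →+* S) (I : Ideal R) (l : List R) :
    (I ⊔ ofList l).map f = I.map f ⊔ ofList (l.map f) := by
  rw [Ideal.map_sup, map_ofList]

theorem isWeaklyRegular_quotient_map (M : Submonoid R) (S : Type*) [CommRing S] [Algebra R S]
    [IsLocalization M S] (h : IsWeaklyRegular (R ⧸ I) l) :
    IsWeaklyRegular (S ⧸ I.map (algebraMap R S)) (l.map (algebraMap R S)) := by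
  induction l generalizing I with
  | nil => exact .nil ..
  | cons a l ih =>
    rw [isWeaklyRegular_quotient_cons_iff] at h
    rw [List.map_cons, isWeaklyRegular_quotient_cons_iff, ← ofList_singleton, ← List.map_singleton,
      ← map_sup_ofList, ofList_singleton]
    refine ⟨isSMulRegular_quotient_iff.2 fun z hz => ?_, ih h.2⟩
    obtain ⟨p, s, rfl⟩ := IsLocalization.exists_mk'_eq M z
    rw [IsLocalization.mul_mk'_eq_mk'_of_mul, IsLocalization.mk'_mem_map_algebraMap_iff] at hz
    obtain ⟨t, ht, htz⟩ := hz
    rw [IsLocalization.mk'_mem_map_algebraMap_iff]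
    exact ⟨t, ht, isSMulRegular_quotient_iff.1 h.1 _ (by rwa [mul_left_comm])⟩

theorem isWeaklyRegular_quotient_of_map {S : Type*} [CommRing S] {f : R →+* S}
    (hf : ∀ i, ((I ⊔ ofList (l.take i)).map f).comap f = I ⊔ ofList (l.take i))
    (h : IsWeaklyRegular (S ⧸ I.map f) (l.map f)) : IsWeaklyRegular (R ⧸ I) l := by
  induction l generalizing I with
  | nil => exact .nil ..
  | cons a l ih =>
    rw [List.map_cons, isWeaklyRegular_quotient_cons_iff, ← ofList_singleton, ← List.map_singleton,
      ← map_sup_ofList, ofList_singleton] at h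
    refine isWeaklyRegular_quotient_cons_iff.2 ⟨?_, ih (fun i => ?_) h.2⟩
    · have hI : (I.map f).comap f = I := by simpa using hf 0
      refine isSMulRegular_quotient_iff.2 fun z hz => ?_
      rw [← hI, mem_comap]
      exact isSMulRegular_quotient_iff.1 h.1 _ (by simpa using mem_map_of_mem f hz)
    · simpa only [List.take_succ_cons, ofList_cons, ← sup_assoc] using hf (i + 1)

theorem exists_sub_algebraMap_mem_map [𝔪.IsMaximal] (S : Type*) [CommRing S] [Algebra R S]
    [IsLocalization.AtPrime S 𝔪] (hrad : 𝔪 ≤ J.radical) (z : S) :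
    ∃ p, z - algebraMap R S p ∈ J.map (algebraMap R S) := by
  obtain ⟨p, s, rfl⟩ := IsLocalization.exists_mk'_eq 𝔪.primeCompl z
  obtain ⟨t, ht⟩ := exists_mul_sub_one_mem hrad s.2
  refine ⟨p * t, ?_⟩
  rw [← unit_mul_mem_iff_mem _ (IsLocalization.map_units S s), mul_sub, IsLocalization.mk'_spec',
    ← map_mul, ← map_sub]
  refine mem_map_of_mem _ ?_
  convert J.mul_mem_left (-p) ht using 1
  ring

theorem hasSimpleSocle_map_iff [𝔪.IsMaximal] (S : Type*) [CommRing S] [Algebra R S]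
    [IsLocalization.AtPrime S 𝔪] (hrad : 𝔪 ≤ J.radical) :
    HasSimpleSocle (𝔪.map (algebraMap R S)) (J.map (algebraMap R S)) ↔ HasSimpleSocle 𝔪 J := by
  rw [HasSimpleSocle.map_iff (exists_sub_algebraMap_mem_map S hrad),
    (isSaturatedAt_of_le_radical hrad).comap_map S]

end Saturation

section Maximal

variable {R : Type*} [CommRing R] {𝔪 I : Ideal R} [𝔪.IsMaximal] {as bs : List R}

local notation "φ" => algebraMap R (Localization.AtPrime 𝔪)

theorem forall_mem_map_mem_maximalIdeal {l : List R} (hl : ∀ a ∈ l, a ∈ 𝔪) :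
    ∀ a ∈ l.map φ, a ∈ maximalIdeal (Localization.AtPrime 𝔪) := by
  simp only [← Localization.AtPrime.map_eq_maximalIdeal, List.forall_mem_map]
  exact fun a ha => mem_map_of_mem _ (hl a ha)

theorem forall_mem_map_mem_radical (ham : ∀ a ∈ as, a ∈ 𝔪) (hrad : 𝔪 ≤ (I ⊔ ofList bs).radical) :
    ∀ a ∈ as.map φ, a ∈ (I.map φ ⊔ ofList (bs.map φ)).radical := by
  simp only [← map_sup_ofList, List.forall_mem_map]
  exact fun a ha => map_radical_le _ (mem_map_of_mem _ (hrad (ham a ha)))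

variable [IsNoetherianRing R]

theorem isWeaklyRegular_of_le_radical (hlen : as.length = bs.length)
    (ham : ∀ a ∈ as, a ∈ 𝔪) (hbm : ∀ b ∈ bs, b ∈ 𝔪) (hreg : IsWeaklyRegular (R ⧸ I) as)
    (hrad : 𝔪 ≤ (I ⊔ ofList bs).radical)
    (hsat : ∀ i, IsSaturatedAt 𝔪 (I ⊔ ofList (bs.take i))) : IsWeaklyRegular (R ⧸ I) bs :=
  isWeaklyRegular_quotient_of_map (fun i => (hsat i).comap_map (Localization.AtPrime 𝔪)) <|
    isWeaklyRegular_of_forall_mem_radical (by simpa using hlen)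
      (forall_mem_map_mem_maximalIdeal ham) (forall_mem_map_mem_maximalIdeal hbm)
      (isWeaklyRegular_quotient_map 𝔪.primeCompl _ hreg) (forall_mem_map_mem_radical ham hrad)

theorem HasSimpleSocle.of_le_radical (hlen : as.length = bs.length)
    (ham : ∀ a ∈ as, a ∈ 𝔪) (hbm : ∀ b ∈ bs, b ∈ 𝔪) (hreg : IsWeaklyRegular (R ⧸ I) as)
    (hrada : 𝔪 ≤ (I ⊔ ofList as).radical) (hradb : 𝔪 ≤ (I ⊔ ofList bs).radical)
    (h : HasSimpleSocle 𝔪 (I ⊔ ofList as)) : HasSimpleSocle 𝔪 (I ⊔ ofList bs) := by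
  rw [← hasSimpleSocle_map_iff (Localization.AtPrime 𝔪) hrada, map_sup_ofList,
    Localization.AtPrime.map_eq_maximalIdeal] at h
  rw [← hasSimpleSocle_map_iff (Localization.AtPrime 𝔪) hradb, map_sup_ofList,
    Localization.AtPrime.map_eq_maximalIdeal]
  exact h.of_forall_mem_radical (by simpa using hlen)
    (forall_mem_map_mem_maximalIdeal ham) (forall_mem_map_mem_maximalIdeal hbm)
    (isWeaklyRegular_quotient_map 𝔪.primeCompl _ hreg) (forall_mem_map_mem_radical ham hradb)

theorem length_le_of_le_radical (hI : I ≤ 𝔪) (ham : ∀ a ∈ as, a ∈ 𝔪) (hbm : ∀ b ∈ bs, b ∈ 𝔪)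
    (hreg : IsWeaklyRegular (R ⧸ I) as) (hrad : 𝔪 ≤ (I ⊔ ofList bs).radical) :
    as.length ≤ bs.length := by
  have hbm' := forall_mem_map_mem_maximalIdeal hbm
  have hle : I.map φ ⊔ ofList (bs.map φ) ≤ maximalIdeal _ :=
    sup_le (Localization.AtPrime.map_eq_maximalIdeal (I := 𝔪) ▸ map_mono hI) (span_le.2 hbm')
  have hradm : maximalIdeal (Localization.AtPrime 𝔪) ≤
      (I.map φ ⊔ ofList (bs.map φ)).radical := by
    rw [← map_sup_ofList, ← Localization.AtPrime.map_eq_maximalIdeal]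
    exact (map_mono hrad).trans (map_radical_le _)
  obtain ⟨u, -, hmu, hu⟩ := exists_mem_colon_notMem (H := ⊤) (IsNoetherian.noetherian _) hradm
    fun h => (maximalIdeal.isMaximal _).ne_top (top_le_iff.1 (h.trans hle))
  simpa using length_le_of_forall_mem_radical (forall_mem_map_mem_maximalIdeal ham) hbm'
    (isWeaklyRegular_quotient_map 𝔪.primeCompl _ hreg) (forall_mem_map_mem_radical ham hrad)
    fun h => hu (h hmu)

end Maximal

open MvPolynomial PreAbstractSimplicialComplex

attribute [local instance] weightedGradedAlgebra

section Polynomial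

variable {σ : Type*}

theorem X_mem_idealOfVars {R : Type*} [CommSemiring R] (i : σ) :
    (X i : MvPolynomial σ R) ∈ idealOfVars σ R :=
  subset_span ⟨i, rfl⟩

theorem mem_idealOfVars_iff {R : Type*} [CommSemiring R] {p : MvPolynomial σ R} :
    p ∈ idealOfVars σ R ↔ constantCoeff p = 0 := by
  rw [← pow_one (idealOfVars σ R), mem_pow_idealOfVars_iff', constantCoeff_eq]
  simp [Finsupp.degree_eq_zero_iff]

instance isMaximal_idealOfVars {F : Type*} [Field F] : (idealOfVars σ F).IsMaximal := by
  have hker : idealOfVars σ F = RingHom.ker (constantCoeff : MvPolynomial σ F →+* F) :=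
    Ideal.ext fun _ => mem_idealOfVars_iff
  exact hker ▸ RingHom.ker_isMaximal_of_surjective _ fun c => ⟨C c, constantCoeff_C _ c⟩

theorem mem_colon_idealOfVars_iff {R : Type*} [CommSemiring R] {J : Ideal (MvPolynomial σ R)}
    {p : MvPolynomial σ R} :
    p ∈ J.colon (idealOfVars σ R : Set (MvPolynomial σ R)) ↔ ∀ i, X i * p ∈ J := by
  simp only [Ideal.colon_span, Submodule.mem_colon, Set.forall_mem_range, smul_eq_mul, mul_comm p]

theorem isWeaklyRegular_map_X {R : Type*} [CommRing R] {S : Set σ} {t : List σ} (ht : t.Nodup)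
    (hS : ∀ i ∈ t, i ∉ S) :
    IsWeaklyRegular (MvPolynomial σ R ⧸ span ((X : σ → MvPolynomial σ R) '' S))
      (t.map X : List (MvPolynomial σ R)) := by
  induction t generalizing S with
  | nil => exact .nil ..
  | cons i t ih =>
    rw [List.nodup_cons] at ht
    refine isWeaklyRegular_quotient_cons_iff.2 ⟨isSMulRegular_quotient_iff.2 fun p hp => ?_, ?_⟩
    · simp only [mem_ideal_span_X_image, support_X_mul, Finset.mem_map, addLeftEmbedding_apply,
        forall_exists_index, and_imp, forall_apply_eq_imp_iff₂] at hp ⊢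
      intro d hd
      obtain ⟨j, hj, hjd⟩ := hp d hd
      have hij : i ≠ j := fun h => hS i List.mem_cons_self (h ▸ hj)
      exact ⟨j, hj, by simpa [hij] using hjd⟩
    · rw [sup_comm, ← span_union, ← Set.insert_eq, ← Set.image_insert_eq]
      refine ih ht.2 fun j hj => ?_
      rintro (rfl | hjS)
      exacts [ht.1 hj, hS j (List.mem_cons_of_mem _ hj) hjS]

theorem degree_le_weight {w : σ → ℕ} (hw : ∀ i, w i ≠ 0) (d : σ →₀ ℕ) :
    d.degree ≤ Finsupp.weight w d := by
  rw [Finsupp.degree_apply, Finsupp.weight_apply, Finsupp.sum]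
  exact Finset.sum_le_sum fun i _ => Nat.le_mul_of_pos_right _ (Nat.pos_of_ne_zero (hw i))

theorem weightedHomogeneousComponent_eq_zero_of_mem_pow {R : Type*} [CommSemiring R] {w : σ → ℕ}
    (hw : ∀ i, w i ≠ 0) {n k : ℕ} (hnk : n < k) {p : MvPolynomial σ R}
    (hp : p ∈ idealOfVars σ R ^ k) : weightedHomogeneousComponent w n p = 0 :=
  weightedHomogeneousComponent_eq_zero' n p fun d hd =>
    (hnk.trans_le (((mem_pow_idealOfVars_iff k p).1 hp d hd).trans (degree_le_weight hw d))).ne'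

theorem isWeightedHomogeneous_aeval {τ R : Type*} [CommSemiring R] {w : σ → ℕ} {w' : τ → ℕ}
    {f : σ → MvPolynomial τ R} (hf : ∀ i, IsWeightedHomogeneous w' (f i) (w i))
    {p : MvPolynomial σ R} {n : ℕ} (hp : IsWeightedHomogeneous w p n) :
    IsWeightedHomogeneous w' (aeval f p) n := by
  rw [p.as_sum, map_sum]
  refine .sum _ _ _ fun d hd => ?_
  rw [aeval_monomial, ← hp (mem_support_iff.1 hd), Finsupp.weight_apply]
  exact (IsWeightedHomogeneous.prod _ _ _ fun i _ => (hf i).pow (d i)).C_mul _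

variable {F : Type*} [Field F] {w : σ → ℕ}

theorem isSaturatedAt_of_isHomogeneous (hw : ∀ i, w i ≠ 0) {J : Ideal (MvPolynomial σ F)}
    (hJ : J.IsHomogeneous (weightedHomogeneousSubmodule F w)) :
    IsSaturatedAt (idealOfVars σ F) J := by
  refine fun s hs => isSMulRegular_quotient_iff.2 fun z hz => ?_
  set t := 1 - C (constantCoeff s)⁻¹ * s with ht
  have htm : t ∈ idealOfVars σ F := by
    rw [mem_idealOfVars_iff] at hs ⊢
    simp [t, hs]
  have htz (k : ℕ) : z - t ^ k * z ∈ J := by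
    have : (1 - t) * z ∈ J := by
      rw [ht, sub_sub_cancel, mul_assoc]
      exact J.mul_mem_left _ hz
    rw [← one_sub_mul]
    exact J.mem_of_dvd (mul_dvd_mul_right (one_sub_dvd_one_sub_pow t k) z) this
  refine (mem_iff_weightedHomogeneousComponent_mem F w hJ z).2 fun n => ?_
  have hzero : weightedHomogeneousComponent w n (t ^ (n + 1) * z) = 0 :=
    weightedHomogeneousComponent_eq_zero_of_mem_pow hw n.lt_succ_self
      (mul_mem_right z _ (pow_mem_pow htm (n + 1)))
  simpa [hzero] using weightedHomogeneousComponent_mem_of_mem F w hJ (htz (n + 1)) n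

theorem isSaturatedAt_sup_ofList_take (hw : ∀ i, w i ≠ 0) {I : Ideal (MvPolynomial σ F)}
    (hI : I.IsHomogeneous (weightedHomogeneousSubmodule F w)) {l : List (MvPolynomial σ F)}
    (hl : ∀ p ∈ l, ∃ n, IsWeightedHomogeneous w p n) (i : ℕ) :
    IsSaturatedAt (idealOfVars σ F) (I ⊔ ofList (l.take i)) :=
  isSaturatedAt_of_isHomogeneous hw <|
    hI.sup (homogeneous_span _ _ fun p hp => hl p (List.mem_of_mem_take hp))

end Polynomial

section Faces

variable {V : Type*} {K L : PreAbstractSimplicialComplex V} {σ τ ρ : Finset V} {v : V}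

theorem isFace_empty : K.IsFace ∅ :=
  .inl rfl

theorem isFace_mono (h : τ ⊆ σ) (hσ : K.IsFace σ) : K.IsFace τ := by
  obtain rfl | hne := τ.eq_empty_or_nonempty
  · exact isFace_empty
  obtain rfl | hσ := hσ
  · exact absurd (Finset.subset_empty.1 h) hne.ne_empty
  · exact .inr ((K.isRelLowerSet_faces hσ).2 h hne)

theorem mem_iff_nonempty_and_isFace : σ ∈ K ↔ σ.Nonempty ∧ K.IsFace σ := by
  refine ⟨fun h => ⟨(K.isRelLowerSet_faces h).1, .inr h⟩, ?_⟩
  rintro ⟨hne, rfl | h⟩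
  exacts [absurd rfl hne.ne_empty, h]

theorem ext_isFace (h : ∀ ρ, K.IsFace ρ ↔ L.IsFace ρ) : K = L :=
  SetLike.ext fun ρ => by simp only [mem_iff_nonempty_and_isFace, h]

variable [DecidableEq V]

/-- The closed star of the vertex `v`: the faces are the sets that form a face together with `v`.
This encoding is the intended one only if `v` is a vertex of `K`. -/
def vertexStar (K : PreAbstractSimplicialComplex V) (v : V) : PreAbstractSimplicialComplex V where
  faces := {ρ | ρ.Nonempty ∧ K.IsFace (insert v ρ)}
  isRelLowerSet_faces := fun _ hρ =>
    ⟨hρ.1, fun _ hsub hne => ⟨hne, isFace_mono (Finset.insert_subset_insert v hsub) hρ.2⟩⟩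

theorem isFace_vertexStar (hv : K.IsFace {v}) :
    (vertexStar K v).IsFace ρ ↔ K.IsFace (insert v ρ) := by
  obtain rfl | hne := ρ.eq_empty_or_nonempty
  · simpa [isFace_empty] using hv
  · exact ⟨fun h => (h.resolve_left hne.ne_empty).2, fun h => .inr ⟨hne, h⟩⟩

theorem isFace_link (hτ : K.IsFace τ) :
    (K.link τ).IsFace ρ ↔ Disjoint τ ρ ∧ K.IsFace (τ ∪ ρ) := by
  obtain rfl | hne := ρ.eq_empty_or_nonempty
  · simpa [isFace_empty] using hτ
  constructor
  · intro h
    obtain ⟨-, t, ht, hsub, rfl⟩ := h.resolve_left hne.ne_empty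
    exact ⟨Finset.disjoint_sdiff, by rwa [Finset.union_sdiff_of_subset hsub]⟩
  · rintro ⟨hd, h⟩
    exact .inr ⟨hne, _, h, Finset.subset_union_left, (Finset.union_sdiff_cancel_left hd).symm⟩

theorem isFace_link_singleton (hv : K.IsFace {v}) :
    (K.link {v}).IsFace ρ ↔ v ∉ ρ ∧ K.IsFace (insert v ρ) := by
  rw [isFace_link hv, Finset.disjoint_singleton_left, Finset.insert_eq]

theorem link_empty : K.link ∅ = K :=
  ext_isFace fun ρ => by simp [isFace_link isFace_empty]

theorem isFace_link_singleton_of_insert (hv : v ∉ τ) (h : K.IsFace (insert v τ)) :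
    (K.link τ).IsFace {v} := by
  rw [isFace_link (isFace_mono (Finset.subset_insert v τ) h), Finset.disjoint_singleton_right,
    Finset.union_comm, ← Finset.insert_eq]
  exact ⟨hv, h⟩

theorem link_insert (hv : v ∉ τ) (h : K.IsFace (insert v τ)) :
    K.link (insert v τ) = (K.link τ).link {v} := by
  refine ext_isFace fun ρ => ?_
  rw [isFace_link h, isFace_link_singleton (isFace_link_singleton_of_insert hv h),
    isFace_link (isFace_mono (Finset.subset_insert v τ) h), Finset.disjoint_insert_left,
    Finset.disjoint_insert_right, Finset.insert_union, Finset.union_insert]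
  tauto

end Faces

section FaceIdeal

variable {V : Type*} {K : PreAbstractSimplicialComplex V} {F : Type*} [Field F] {v : V}
  {p : MvPolynomial V F}

theorem prod_X_eq_monomial {σ : Finset V} :
    (∏ j ∈ σ, X j : MvPolynomial V F) = monomial (∑ j ∈ σ, Finsupp.single j 1) 1 := by
  rw [monomial_sum_one]
  rfl

theorem sum_single_le_iff {σ : Finset V} {d : V →₀ ℕ} :
    (∑ j ∈ σ, Finsupp.single j 1) ≤ d ↔ σ ⊆ d.support := by
  classical
  have happly (i : V) : (∑ j ∈ σ, Finsupp.single j 1 : V →₀ ℕ) i = if i ∈ σ then 1 else 0 := by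
    simp [Finsupp.finsetSum_apply, Finsupp.single_apply]
  simp only [Finsupp.le_def, happly, Finset.subset_iff, Finsupp.mem_support_iff,
    ← Nat.one_le_iff_ne_zero]
  refine forall_congr' fun i => ?_
  split_ifs with hi <;> simp [hi]

theorem mem_stanleyReisnerIdeal_iff :
    p ∈ K.stanleyReisnerIdeal F ↔ ∀ d ∈ p.support, ¬ K.IsFace d.support := by
  have hgen : {f : MvPolynomial V F | ∃ σ : Finset V, ¬ K.IsFace σ ∧ f = ∏ j ∈ σ, X j} =
      (fun s => monomial s (1 : F)) ''
        ((fun σ : Finset V => ∑ j ∈ σ, Finsupp.single j 1) '' {σ | ¬ K.IsFace σ}) := by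
    ext f
    simp [prod_X_eq_monomial, eq_comm]
  rw [stanleyReisnerIdeal, hgen, mem_ideal_span_monomial_image]
  simp only [Set.exists_mem_image, sum_single_le_iff, Set.mem_ofPred_eq]
  exact forall₂_congr fun d _ =>
    ⟨fun ⟨_, hσ, hsub⟩ hd => hσ (isFace_mono hsub hd), fun hd => ⟨_, hd, subset_rfl⟩⟩

theorem isHomogeneous_stanleyReisnerIdeal (w : V → ℕ) :
    (K.stanleyReisnerIdeal F).IsHomogeneous (weightedHomogeneousSubmodule F w) := by
  refine homogeneous_span _ _ ?_
  rintro _ ⟨σ, -, rfl⟩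
  exact ⟨_, .prod σ _ _ fun i _ => isWeightedHomogeneous_X F w i⟩

theorem stanleyReisnerIdeal_le_idealOfVars : K.stanleyReisnerIdeal F ≤ idealOfVars V F := by
  intro p hp
  rw [mem_idealOfVars_iff, constantCoeff_eq]
  by_contra h
  exact mem_stanleyReisnerIdeal_iff.1 hp 0 (mem_support_iff.2 h) isFace_empty

variable [DecidableEq V]

theorem X_mul_mem_iff (hv : K.IsFace {v}) :
    X v * p ∈ K.stanleyReisnerIdeal F ↔ p ∈ (vertexStar K v).stanleyReisnerIdeal F := by
  have hsupp (d : V →₀ ℕ) : (Finsupp.single v 1 + d).support = insert v d.support := by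
    ext i
    obtain rfl | hi := eq_or_ne i v <;> simp [*]
  simp only [mem_stanleyReisnerIdeal_iff, isFace_vertexStar hv, support_X_mul, Finset.mem_map,
    addLeftEmbedding_apply, forall_exists_index, and_imp, forall_apply_eq_imp_iff₂, hsupp]

theorem stanleyReisnerIdeal_le_vertexStar (hv : K.IsFace {v}) :
    K.stanleyReisnerIdeal F ≤ (vertexStar K v).stanleyReisnerIdeal F :=
  fun _ hp => (X_mul_mem_iff hv).1 (mul_mem_left _ _ hp)

theorem stanleyReisnerIdeal_link (hv : K.IsFace {v}) :
    (K.link {v}).stanleyReisnerIdeal F =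
      (vertexStar K v).stanleyReisnerIdeal F ⊔ span {X v} := by
  refine le_antisymm (span_le.2 ?_) (sup_le (span_mono ?_) ?_)
  · rintro _ ⟨σ, hσ, rfl⟩
    rw [isFace_link_singleton hv, ← isFace_vertexStar hv] at hσ
    by_cases hvσ : v ∈ σ
    · exact Submodule.mem_sup_right (mem_span_singleton.2 (Finset.dvd_prod_of_mem _ hvσ))
    · exact Submodule.mem_sup_left (subset_span ⟨σ, fun h => hσ ⟨hvσ, h⟩, rfl⟩)
  · rintro _ ⟨σ, hσ, rfl⟩
    rw [isFace_vertexStar hv] at hσ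
    exact ⟨σ, fun h => hσ ((isFace_link_singleton hv).1 h).2, rfl⟩
  · rw [span_singleton_le_iff_mem]
    exact subset_span ⟨{v}, by simp [isFace_link_singleton hv], by simp⟩

end FaceIdeal

section SquareVar

variable {V : Type*} {v i : V} {d : V →₀ ℕ}

/-- The exponent vector `d` with the exponent of `v` doubled. -/
noncomputable def doubleExp (v : V) (d : V →₀ ℕ) : V →₀ ℕ :=
  d + .single v (d v)

theorem doubleExp_self : doubleExp v d v = 2 * d v := by
  simp [doubleExp, two_mul]

theorem doubleExp_of_ne (h : i ≠ v) : doubleExp v d i = d i := by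
  simp [doubleExp, h]

theorem doubleExp_injective : Function.Injective (doubleExp v) := by
  intro d e h
  ext i
  have hi := DFunLike.congr_fun h i
  obtain rfl | hne := eq_or_ne i v
  · simpa [doubleExp_self] using hi
  · simpa [doubleExp_of_ne hne] using hi

variable [DecidableEq V]

/-- The endomorphism of the polynomial ring that squares the variable `v` and fixes the others;
as a module over its image the ring is free with basis `1, v`. -/
noncomputable def squareVar (R : Type*) [CommSemiring R] (v : V) :
    MvPolynomial V R →ₐ[R] MvPolynomial V R :=
  aeval (Function.update X v (X v ^ 2))

section Semiring

variable {R : Type*} [CommSemiring R]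

@[simp]
theorem squareVar_X_self : squareVar R v (X v) = X v ^ 2 := by simp [squareVar]

@[simp]
theorem squareVar_X_of_ne (h : i ≠ v) : squareVar R v (X i) = X i := by simp [squareVar, h]

@[simp]
theorem squareVar_C (c : R) : squareVar R v (C c) = C c := algHom_C _ c

theorem squareVar_monomial (c : R) :
    squareVar R v (monomial d c) = monomial (doubleExp v d) c := by
  induction d using Finsupp.induction_linear generalizing c with
  | zero => simp [doubleExp, monomial_zero']
  | add f g hf hg =>
    have hadd : doubleExp v (f + g) = doubleExp v f + doubleExp v g := by
      simp [doubleExp, add_add_add_comm]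
    rw [← mul_one c, ← monomial_mul, map_mul, hf, hg, hadd, monomial_mul]
  | single i n =>
    rw [← mul_one c, ← C_mul_monomial, ← X_pow_eq_monomial, map_mul, map_pow, squareVar_C]
    obtain rfl | hne := eq_or_ne i v
    · rw [squareVar_X_self, ← pow_mul, X_pow_eq_monomial, C_mul_monomial, two_mul]
      simp [doubleExp, ← Finsupp.single_add]
    · simp [squareVar_X_of_ne hne, doubleExp, hne, X_pow_eq_monomial, C_mul_monomial]

theorem coeff_doubleExp_squareVar (p : MvPolynomial V R) :
    coeff (doubleExp v d) (squareVar R v p) = coeff d p := by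
  induction p using MvPolynomial.induction_on' with
  | monomial e c => simp [squareVar_monomial, coeff_monomial, doubleExp_injective.eq_iff]
  | add p q hp hq => rw [map_add, coeff_add, coeff_add, hp, hq]

theorem coeff_squareVar_of_odd (hd : Odd (d v)) (p : MvPolynomial V R) :
    coeff d (squareVar R v p) = 0 := by
  induction p using MvPolynomial.induction_on' with
  | monomial e c =>
    rw [squareVar_monomial, coeff_monomial, if_neg]
    rintro rfl
    exact Nat.not_odd_iff_even.2 (even_two_mul _) (doubleExp_self ▸ hd)
  | add p q hp hq => rw [map_add, coeff_add, hp, hq, add_zero]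

theorem eq_zero_of_squareVar_add_eq_zero {p₀ p₁ : MvPolynomial V R}
    (h : squareVar R v p₀ + X v * squareVar R v p₁ = 0) : p₀ = 0 ∧ p₁ = 0 := by
  refine ⟨MvPolynomial.ext _ _ fun d => ?_, MvPolynomial.ext _ _ fun d => ?_⟩
  · have hcoeff := congrArg (coeff (doubleExp v d)) h
    rw [coeff_add, coeff_doubleExp_squareVar, coeff_X_mul'] at hcoeff
    split_ifs at hcoeff with hv
    · rwa [coeff_squareVar_of_odd, add_zero] at hcoeff
      rw [Finsupp.mem_support_iff] at hv
      rw [Finsupp.tsub_apply, Finsupp.single_eq_same]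
      rw [doubleExp_self] at hv ⊢
      exact ⟨d v - 1, by lia⟩
    · simpa using hcoeff
  · have hcoeff := congrArg (coeff (.single v 1 + doubleExp v d)) h
    rwa [coeff_add, coeff_X_mul, coeff_doubleExp_squareVar, coeff_squareVar_of_odd, zero_add]
      at hcoeff
    rw [Finsupp.add_apply, Finsupp.single_eq_same, doubleExp_self]
    exact ⟨d v, by lia⟩

theorem exists_eq_squareVar_add (v : V) (p : MvPolynomial V R) :
    ∃ p₀ p₁, p = squareVar R v p₀ + X v * squareVar R v p₁ := by
  induction p using MvPolynomial.induction_on with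
  | C a => exact ⟨C a, 0, by simp⟩
  | add p q hp hq =>
    obtain ⟨p₀, p₁, rfl⟩ := hp
    obtain ⟨q₀, q₁, rfl⟩ := hq
    exact ⟨p₀ + q₀, p₁ + q₁, by rw [map_add, map_add]; ring⟩
  | mul_X p i hp =>
    obtain ⟨p₀, p₁, rfl⟩ := hp
    obtain rfl | hi := eq_or_ne i v
    · exact ⟨X i * p₁, p₀, by rw [map_mul, squareVar_X_self]; ring⟩
    · exact ⟨p₀ * X i, p₁ * X i, by simp only [map_mul, squareVar_X_of_ne hi]; ring⟩

theorem squareVar_mem_idealOfVars {p : MvPolynomial V R} (hp : p ∈ idealOfVars V R) :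
    squareVar R v p ∈ idealOfVars V R := by
  suffices hle : idealOfVars V R ≤ (idealOfVars V R).comap (squareVar R v) from hle hp
  refine span_le.2 (Set.range_subset_iff.2 fun i => ?_)
  obtain rfl | hi := eq_or_ne i v
  · simpa using pow_mem_of_mem _ (X_mem_idealOfVars i) 2 two_pos
  · simpa [hi] using X_mem_idealOfVars i

theorem isWeightedHomogeneous_squareVar {p : MvPolynomial V R} {n : ℕ}
    (hp : IsWeightedHomogeneous (fun _ => 2) p n) :
    IsWeightedHomogeneous (fun i => if i = v then 1 else 2) (squareVar R v p) n := by
  refine isWeightedHomogeneous_aeval (fun i => ?_) hp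
  obtain rfl | hi := eq_or_ne i v
  · simpa using (isWeightedHomogeneous_X R (fun j => if j = i then (1 : ℕ) else 2) i).pow 2
  · simpa [hi] using isWeightedHomogeneous_X R (fun j => if j = v then 1 else 2) i

theorem exists_eq_squareVar_add_of_mem_span {A B : Ideal (MvPolynomial V R)} (hAB : A ≤ B)
    (hBA : ∀ b ∈ B, X v * b ∈ A) {s : Set (MvPolynomial V R)}
    (hs : ∀ p ∈ s, ∃ a ∈ A, ∃ b ∈ B, p = squareVar R v a + X v * squareVar R v b) :
    ∀ p ∈ span s, ∃ a ∈ A, ∃ b ∈ B, p = squareVar R v a + X v * squareVar R v b := by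
  intro p hp
  induction hp using Submodule.span_induction with
  | mem p hp => exact hs p hp
  | zero => exact ⟨0, A.zero_mem, 0, B.zero_mem, by simp⟩
  | add p q _ _ hp hq =>
    obtain ⟨a, ha, b, hb, rfl⟩ := hp
    obtain ⟨a', ha', b', hb', rfl⟩ := hq
    exact ⟨a + a', add_mem ha ha', b + b', add_mem hb hb', by rw [map_add, map_add]; ring⟩
  | smul c p _ hp =>
    obtain ⟨a, ha, b, hb, rfl⟩ := hp
    obtain ⟨c₀, c₁, rfl⟩ := exists_eq_squareVar_add v c
    refine ⟨c₀ * a + c₁ * (X v * b), add_mem (A.mul_mem_left _ ha) (A.mul_mem_left _ (hBA b hb)),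
      c₀ * b + c₁ * a, add_mem (B.mul_mem_left _ hb) (B.mul_mem_left _ (hAB ha)), ?_⟩
    simp only [map_add, map_mul, squareVar_X_self, smul_eq_mul]
    ring

end Semiring

section FaceIdeal

variable {F : Type*} [Field F] {K : PreAbstractSimplicialComplex V}
  {J : Ideal (MvPolynomial V F)} {l : List (MvPolynomial V F)} {p p₀ p₁ : MvPolynomial V F}

theorem squareVar_mem_stanleyReisnerIdeal (hp : p ∈ K.stanleyReisnerIdeal F) :
    squareVar F v p ∈ K.stanleyReisnerIdeal F := by
  suffices hle : K.stanleyReisnerIdeal F ≤ (K.stanleyReisnerIdeal F).comap (squareVar F v) from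
    hle hp
  refine span_le.2 ?_
  rintro _ ⟨σ, hσ, rfl⟩
  rw [SetLike.mem_coe, mem_comap, map_prod]
  refine mem_of_dvd _ (Finset.prod_dvd_prod_of_dvd X _ fun i _ => ?_) (subset_span ⟨σ, hσ, rfl⟩)
  obtain rfl | hi := eq_or_ne i v
  · simp [pow_two]
  · rw [squareVar_X_of_ne hi]

theorem exists_eq_squareVar_add_of_prod {σ : Finset V} (hv : K.IsFace {v}) (hσ : ¬ K.IsFace σ) :
    ∃ a ∈ K.stanleyReisnerIdeal F, ∃ b ∈ (vertexStar K v).stanleyReisnerIdeal F,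
      ∏ j ∈ σ, X j = squareVar F v a + X v * squareVar F v b := by
  have hfix {τ : Finset V} (hτ : v ∉ τ) : squareVar F v (∏ j ∈ τ, X j) = ∏ j ∈ τ, X j := by
    rw [map_prod]
    exact Finset.prod_congr rfl fun i hi => squareVar_X_of_ne (ne_of_mem_of_not_mem hi hτ)
  by_cases hvσ : v ∈ σ
  · refine ⟨0, zero_mem _, ∏ j ∈ σ.erase v, X j, subset_span ⟨_, ?_, rfl⟩, ?_⟩
    · rwa [isFace_vertexStar hv, Finset.insert_erase hvσ]
    · rw [hfix (σ.notMem_erase v), map_zero, zero_add, Finset.mul_prod_erase σ X hvσ]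
  · exact ⟨_, subset_span ⟨σ, hσ, rfl⟩, 0, zero_mem _, by rw [hfix hvσ, map_zero]; ring⟩

theorem X_mul_mem_sup (hv : K.IsFace {v}) (hp : p ∈ (vertexStar K v).stanleyReisnerIdeal F ⊔ J) :
    X v * p ∈ K.stanleyReisnerIdeal F ⊔ J := by
  obtain ⟨i, hi, j, hj, rfl⟩ := Submodule.mem_sup.1 hp
  rw [mul_add]
  exact Submodule.add_mem_sup ((X_mul_mem_iff hv).2 hi) (J.mul_mem_left _ hj)

theorem squareVar_add_mem_iff (hv : K.IsFace {v}) :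
    squareVar F v p₀ + X v * squareVar F v p₁ ∈
        K.stanleyReisnerIdeal F ⊔ J.map (squareVar F v) ↔
      p₀ ∈ K.stanleyReisnerIdeal F ⊔ J ∧ p₁ ∈ (vertexStar K v).stanleyReisnerIdeal F ⊔ J := by
  have hAB := sup_le_sup_right (stanleyReisnerIdeal_le_vertexStar (F := F) hv) J
  constructor
  · rw [stanleyReisnerIdeal, Ideal.map, ← span_union]
    intro hmem
    obtain ⟨a, ha, b, hb, hab⟩ := exists_eq_squareVar_add_of_mem_span hAB
      (fun _ => X_mul_mem_sup hv) (by
      rintro _ (⟨σ, hσ, rfl⟩ | ⟨j, hj, rfl⟩)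
      · obtain ⟨a, ha, b, hb, h⟩ := exists_eq_squareVar_add_of_prod (F := F) hv hσ
        exact ⟨a, Submodule.mem_sup_left ha, b, Submodule.mem_sup_left hb, h⟩
      · exact ⟨j, Submodule.mem_sup_right hj, 0, zero_mem _, by simp⟩) _ hmem
    obtain ⟨h₀, h₁⟩ := eq_zero_of_squareVar_add_eq_zero (R := F) (v := v) (p₀ := p₀ - a)
      (p₁ := p₁ - b) (by rw [map_sub, map_sub]; linear_combination hab)
    rw [sub_eq_zero.1 h₀, sub_eq_zero.1 h₁]
    exact ⟨ha, hb⟩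
  · rintro ⟨h₀, h₁⟩
    obtain ⟨i, hi, j, hj, rfl⟩ := Submodule.mem_sup.1 h₀
    obtain ⟨i', hi', j', hj', rfl⟩ := Submodule.mem_sup.1 h₁
    simp only [map_add, mul_add]
    rw [add_add_add_comm]
    have hX : X v * squareVar F v i' ∈ K.stanleyReisnerIdeal F :=
      (X_mul_mem_iff hv).2 (squareVar_mem_stanleyReisnerIdeal hi')
    exact Submodule.add_mem_sup (add_mem (squareVar_mem_stanleyReisnerIdeal hi) hX)
      (add_mem (mem_map_of_mem _ hj) (mul_mem_left _ _ (mem_map_of_mem _ hj')))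

theorem squareVar_mem_iff (hv : K.IsFace {v}) :
    squareVar F v p ∈ K.stanleyReisnerIdeal F ⊔ J.map (squareVar F v) ↔
      p ∈ K.stanleyReisnerIdeal F ⊔ J := by
  simpa using squareVar_add_mem_iff (p₁ := 0) hv

theorem X_mul_squareVar_mem_iff (hv : K.IsFace {v}) :
    X v * squareVar F v p ∈ K.stanleyReisnerIdeal F ⊔ J.map (squareVar F v) ↔
      p ∈ (vertexStar K v).stanleyReisnerIdeal F ⊔ J := by
  simpa using squareVar_add_mem_iff (p₀ := 0) hv

theorem isWeaklyRegular_vertexStar_of_map_squareVar (hv : K.IsFace {v})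
    (h : IsWeaklyRegular (MvPolynomial V F ⧸ K.stanleyReisnerIdeal F ⊔ J.map (squareVar F v))
      (l.map (squareVar F v))) :
    IsWeaklyRegular (MvPolynomial V F ⧸ (vertexStar K v).stanleyReisnerIdeal F ⊔ J) l := by
  induction l generalizing J with
  | nil => exact .nil ..
  | cons a l ih =>
    rw [List.map_cons, isWeaklyRegular_quotient_cons_iff] at h
    refine isWeaklyRegular_quotient_cons_iff.2 ⟨isSMulRegular_quotient_iff.2 fun z hz => ?_, ?_⟩
    · rw [← X_mul_squareVar_mem_iff hv] at hz ⊢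
      refine isSMulRegular_quotient_iff.1 h.1 _ ?_
      rwa [map_mul, mul_left_comm] at hz
    · rw [sup_assoc]
      refine ih ?_
      rw [Ideal.map_sup, map_span, Set.image_singleton, ← sup_assoc]
      exact h.2

end FaceIdeal

end SquareVar

section Parameters

variable {V : Type*} {K : PreAbstractSimplicialComplex V} {F : Type*} [Field F]
  {l b : List (MvPolynomial V F)} {σ : Finset V} {v : V}

/-- The list `l` of polynomials represents a sequence of homogeneous elements of positive degree
generating an ideal of `F(K)` primary to the irrelevant ideal. Neither algebraic independence nor
minimality of the length is required. -/
structure IsParameterList (K : PreAbstractSimplicialComplex V) (l : List (MvPolynomial V F)) :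
    Prop where
  mem : ∀ p ∈ l, p ∈ idealOfVars V F
  homogeneous : ∀ p ∈ l, ∃ n, IsWeightedHomogeneous (fun _ => 2) p n
  le_radical : idealOfVars V F ≤ (K.stanleyReisnerIdeal F ⊔ ofList l).radical

theorem card_le_length [Finite V] (hσ : K.IsFace σ) (hl : IsParameterList K l) :
    σ.card ≤ l.length := by
  classical
  have hle : K.stanleyReisnerIdeal F ≤ span (X '' (σ : Set V)ᶜ) := by
    refine span_le.2 ?_
    rintro _ ⟨τ, hτ, rfl⟩
    obtain ⟨j, hj, hjσ⟩ := Finset.not_subset.1 fun h => hτ (isFace_mono h hσ)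
    exact mem_of_dvd _ (Finset.dvd_prod_of_mem _ hj) (subset_span ⟨j, by simpa using hjσ, rfl⟩)
  have hreg := isWeaklyRegular_map_X (R := F) (S := (σ : Set V)ᶜ) σ.nodup_toList (by simp)
  simpa using length_le_of_le_radical (𝔪 := idealOfVars V F)
    (span_mono (Set.image_subset_range _ _))
    (List.forall_mem_map.2 fun i _ => X_mem_idealOfVars i) hl.mem hreg
    (hl.le_radical.trans (radical_mono (sup_le_sup_right hle _)))

variable [DecidableEq V]

theorem isParameterList_vertexStar (hv : K.IsFace {v}) (hl : IsParameterList K l) :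
    IsParameterList (vertexStar K v) l where
  mem := hl.mem
  homogeneous := hl.homogeneous
  le_radical := hl.le_radical.trans
    (radical_mono (sup_le_sup_right (stanleyReisnerIdeal_le_vertexStar hv) _))

theorem isParameterList_vertexStar_cons (hv : K.IsFace {v}) (hb : IsParameterList (K.link {v}) b) :
    IsParameterList (vertexStar K v) (X v :: b) where
  mem := List.forall_mem_cons.2 ⟨X_mem_idealOfVars v, hb.mem⟩
  homogeneous := List.forall_mem_cons.2 ⟨⟨2, isWeightedHomogeneous_X F _ v⟩, hb.homogeneous⟩
  le_radical := by
    rw [ofList_cons, ← sup_assoc, ← stanleyReisnerIdeal_link hv]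
    exact hb.le_radical

theorem ofList_map_squareVar : ofList (l.map (squareVar F v)) = (ofList l).map (squareVar F v) :=
  (map_ofList (squareVar F v).toRingHom l).symm

theorem le_radical_map_squareVar (hv : K.IsFace {v}) (hl : IsParameterList K l) :
    idealOfVars V F ≤ (K.stanleyReisnerIdeal F ⊔ ofList (l.map (squareVar F v))).radical := by
  rw [ofList_map_squareVar]
  refine span_le.2 (Set.range_subset_iff.2 fun i => ?_)
  obtain ⟨n, hn⟩ := hl.le_radical (X_mem_idealOfVars i)
  rw [← squareVar_mem_iff hv, map_pow] at hn
  obtain rfl | hi := eq_or_ne i v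
  · rw [squareVar_X_self, ← pow_mul] at hn
    exact ⟨_, hn⟩
  · rw [squareVar_X_of_ne hi] at hn
    exact ⟨_, hn⟩

theorem forall_mem_map_squareVar (hl : IsParameterList K l) :
    ∀ p ∈ l.map (squareVar F v), p ∈ idealOfVars V F :=
  List.forall_mem_map.2 fun p hp => squareVar_mem_idealOfVars (hl.mem p hp)

theorem squareVar_mem_colon (hv : K.IsFace {v}) {I : Ideal (MvPolynomial V F)}
    {u : MvPolynomial V F} (hu : u ∈ (vertexStar K v).stanleyReisnerIdeal F ⊔ I)
    (hmu : u ∈ (K.stanleyReisnerIdeal F ⊔ I).colon (idealOfVars V F : Set (MvPolynomial V F))) :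
    squareVar F v u ∈ (K.stanleyReisnerIdeal F ⊔ I.map (squareVar F v)).colon
      (idealOfVars V F : Set (MvPolynomial V F)) := by
  rw [mem_colon_idealOfVars_iff] at hmu ⊢
  intro i
  obtain rfl | hi := eq_or_ne i v
  · exact (X_mul_squareVar_mem_iff hv).2 hu
  · simpa [hi] using (squareVar_mem_iff hv).2 (hmu i)

theorem X_mul_squareVar_mem_colon (hv : K.IsFace {v}) {I : Ideal (MvPolynomial V F)}
    {p : MvPolynomial V F}
    (hp : p ∈ ((vertexStar K v).stanleyReisnerIdeal F ⊔ I).colon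
      (idealOfVars V F : Set (MvPolynomial V F)))
    (hXp : X v * p ∈ K.stanleyReisnerIdeal F ⊔ I) :
    X v * squareVar F v p ∈ (K.stanleyReisnerIdeal F ⊔ I.map (squareVar F v)).colon
      (idealOfVars V F : Set (MvPolynomial V F)) := by
  rw [mem_colon_idealOfVars_iff] at hp ⊢
  intro i
  obtain rfl | hi := eq_or_ne i v
  · simpa [pow_two, mul_assoc] using (squareVar_mem_iff hv).2 hXp
  · rw [mul_left_comm]
    simpa [hi] using (X_mul_squareVar_mem_iff hv).2 (hp i)

theorem HasSimpleSocle.vertexStar_of_squareVar [Finite V] (hv : K.IsFace {v})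
    (hl : IsParameterList K l)
    (h : HasSimpleSocle (idealOfVars V F) (K.stanleyReisnerIdeal F ⊔ ofList l))
    (h' : HasSimpleSocle (idealOfVars V F)
      (K.stanleyReisnerIdeal F ⊔ ofList (l.map (squareVar F v)))) :
    HasSimpleSocle (idealOfVars V F) ((vertexStar K v).stanleyReisnerIdeal F ⊔ ofList l) := by
  set A := K.stanleyReisnerIdeal F ⊔ ofList l
  set B := (vertexStar K v).stanleyReisnerIdeal F ⊔ ofList l
  rw [ofList_map_squareVar] at h'
  set D := K.stanleyReisnerIdeal F ⊔ (ofList l).map (squareVar F v)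
  have hAB : A ≤ B := sup_le_sup_right (stanleyReisnerIdeal_le_vertexStar hv) _
  have hfg := idealOfVars_fg V F
  by_cases hBA : B ≤ A
  · rwa [le_antisymm hBA hAB]
  obtain ⟨u, huB, hmu, huA⟩ := exists_mem_colon_notMem hfg hl.le_radical hBA
  -- `u` stays nonzero after squaring `v`, so it generates the socle modulo `D`; compare the
  -- components of `X v * squareVar b ≡ k * squareVar u` along the basis `1, v`.
  have hinj : ∀ b ∈ B.colon (idealOfVars V F : Set (MvPolynomial V F)), X v * b ∈ A → b ∈ B := by
    intro b hb hXb
    obtain ⟨k, hk⟩ := h'.exists_sub_mul_mem (squareVar_mem_colon hv huB hmu)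
      (fun h => huA ((squareVar_mem_iff hv).1 h)) (X_mul_squareVar_mem_colon hv hb hXb)
    obtain ⟨k₀, k₁, rfl⟩ := exists_eq_squareVar_add v k
    have hsplit : squareVar F v (-(k₀ * u)) + X v * squareVar F v (b - k₁ * u) ∈ D := by
      convert hk using 1
      simp only [map_neg, map_sub, map_mul]
      ring
    exact (B.sub_mem_iff_left (B.mul_mem_left k₁ huB)).1 ((squareVar_add_mem_iff hv).1 hsplit).2
  have hlB := isParameterList_vertexStar hv hl
  have hB : ¬ (⊤ : Ideal (MvPolynomial V F)) ≤ B := fun hle =>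
    isMaximal_idealOfVars.ne_top (top_le_iff.1 (hle.trans
      (sup_le stanleyReisnerIdeal_le_idealOfVars (span_le.2 hlB.mem))))
  obtain ⟨s, -, hs⟩ := exists_mem_colon_notMem hfg hlB.le_radical hB
  refine h.of_mul (fun b hb => ?_) hinj ⟨s, hs⟩
  exact X_mul_mem_sup hv hb

section Regular

variable [Finite V] (hv : K.IsFace {v}) (hl : IsParameterList K l)
  (hreg : IsWeaklyRegular (MvPolynomial V F ⧸ K.stanleyReisnerIdeal F) l)

include hv hl hreg

theorem isWeaklyRegular_map_squareVar :
    IsWeaklyRegular (MvPolynomial V F ⧸ K.stanleyReisnerIdeal F) (l.map (squareVar F v)) := by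
  refine isWeaklyRegular_of_le_radical (𝔪 := idealOfVars V F) (by simp) hl.mem
    (forall_mem_map_squareVar hl) hreg (le_radical_map_squareVar hv hl) <|
    isSaturatedAt_sup_ofList_take (w := fun i => if i = v then 1 else 2)
      (fun i => by split_ifs <;> simp) (isHomogeneous_stanleyReisnerIdeal _)
      (List.forall_mem_map.2 fun p hp => ?_)
  obtain ⟨n, hn⟩ := hl.homogeneous p hp
  exact ⟨n, isWeightedHomogeneous_squareVar hn⟩

theorem isWeaklyRegular_vertexStar :
    IsWeaklyRegular (MvPolynomial V F ⧸ (vertexStar K v).stanleyReisnerIdeal F) l := by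
  have hmap := isWeaklyRegular_map_squareVar hv hl hreg
  rw [← sup_bot_eq (K.stanleyReisnerIdeal F), ← Ideal.map_bot (f := squareVar F v)] at hmap
  have hstar := isWeaklyRegular_vertexStar_of_map_squareVar hv hmap
  rwa [sup_bot_eq] at hstar

theorem length_le_of_link (hb : IsParameterList (K.link {v}) b) : l.length ≤ b.length + 1 := by
  have hb' := isParameterList_vertexStar_cons hv hb
  exact length_le_of_le_radical stanleyReisnerIdeal_le_idealOfVars hl.mem hb'.mem
    (isWeaklyRegular_vertexStar hv hl hreg) hb'.le_radical

theorem isWeaklyRegular_link (hb : IsParameterList (K.link {v}) b)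
    (hlen : l.length = b.length + 1) :
    IsWeaklyRegular (MvPolynomial V F ⧸ (K.link {v}).stanleyReisnerIdeal F) b := by
  have hb' := isParameterList_vertexStar_cons hv hb
  rw [stanleyReisnerIdeal_link hv]
  exact (isWeaklyRegular_quotient_cons_iff.1 <|
    isWeaklyRegular_of_le_radical hlen hl.mem hb'.mem (isWeaklyRegular_vertexStar hv hl hreg)
      hb'.le_radical (isSaturatedAt_sup_ofList_take (fun _ => two_ne_zero)
        (isHomogeneous_stanleyReisnerIdeal _) hb'.homogeneous)).2

theorem HasSimpleSocle.link (hb : IsParameterList (K.link {v}) b) (hlen : l.length = b.length + 1)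
    (h : HasSimpleSocle (idealOfVars V F) (K.stanleyReisnerIdeal F ⊔ ofList l)) :
    HasSimpleSocle (idealOfVars V F) ((K.link {v}).stanleyReisnerIdeal F ⊔ ofList b) := by
  have hb' := isParameterList_vertexStar_cons hv hb
  have hsq := h.of_le_radical (by simp) hl.mem (forall_mem_map_squareVar hl) hreg hl.le_radical
    (le_radical_map_squareVar hv hl)
  rw [stanleyReisnerIdeal_link hv, sup_assoc, ← ofList_cons]
  exact (h.vertexStar_of_squareVar hv hl hsq).of_le_radical hlen hl.mem hb'.mem
    (isWeaklyRegular_vertexStar hv hl hreg) (isParameterList_vertexStar hv hl).le_radical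
    hb'.le_radical

end Regular

end Parameters

section ElementarySymmetric

variable {σ R : Type*} [CommRing R]

theorem algebraicIndependent_esymm [Fintype σ] {n : ℕ} (hn : n ≤ Fintype.card σ) :
    AlgebraicIndependent R fun i : Fin n => esymm σ R (i + 1) := by
  intro p q hpq
  refine esymmAlgHom_injective R hn (Subtype.ext ?_)
  rwa [esymmAlgHom_apply, esymmAlgHom_apply]

theorem esymm_mem_idealOfVars [Fintype σ] {n : ℕ} (hn : n ≠ 0) : esymm σ R n ∈ idealOfVars σ R := by
  refine sum_mem _ fun t ht => ?_
  obtain ⟨j, hj⟩ : t.Nonempty := by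
    rwa [← Finset.card_ne_zero, (Finset.mem_powersetCard.1 ht).2]
  exact mem_of_dvd _ (Finset.dvd_prod_of_mem _ hj) (X_mem_idealOfVars j)

theorem isWeightedHomogeneous_esymm [Fintype σ] (k n : ℕ) :
    IsWeightedHomogeneous (fun _ : σ => k) (esymm σ R n) (n * k) := by
  refine IsWeightedHomogeneous.sum _ _ _ fun t ht => ?_
  have hprod := IsWeightedHomogeneous.prod t (fun i => (X i : MvPolynomial σ R)) (fun _ => k)
    (w := fun _ => k) fun i _ => isWeightedHomogeneous_X R _ i
  rwa [Finset.sum_const, (Finset.mem_powersetCard.1 ht).2, smul_eq_mul] at hprod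

theorem X_pow_card_mem_span_esymm [Fintype σ] (i : σ) :
    X i ^ Fintype.card σ ∈ span (Set.range fun n => esymm σ R (n + 1)) := by
  -- evaluate `∏ j, (T + X j) = ∑ n, e_n T ^ (card σ - n)` at `T = -X i`
  have hroot := congrArg (Polynomial.eval (-X i)) (prod_C_add_X_eq_sum_esymm R σ)
  rw [Polynomial.eval_prod, Finset.prod_eq_zero (Finset.mem_univ i) (by simp),
    Finset.sum_range_succ', Polynomial.eval_add] at hroot
  simp only [Polynomial.eval_finsetSum, Polynomial.eval_mul, Polynomial.eval_C,
    Polynomial.eval_pow, Polynomial.eval_X, esymm_zero, one_mul, Nat.sub_zero] at hroot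
  have hpow := neg_mem (sum_mem (span (Set.range fun n => esymm σ R (n + 1)))
    fun n (_ : n ∈ Finset.range (Fintype.card σ)) =>
      mul_mem_right ((-X i) ^ (Fintype.card σ - (n + 1))) _ (subset_span ⟨n, rfl⟩))
  rw [← eq_neg_of_add_eq_zero_right hroot.symm, neg_pow] at hpow
  exact (unit_mul_mem_iff_mem _ (isUnit_one.neg.pow _)).1 hpow

theorem coeff_killCompl {τ : Type*} {f : σ → τ} (hf : Function.Injective f)
    (p : MvPolynomial τ R) (d : σ →₀ ℕ) :
    coeff d (killCompl hf p) = coeff (d.mapDomain f) p := by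
  classical
  induction p using MvPolynomial.induction_on' with
  | monomial e c =>
    by_cases he : ↑e.support ⊆ Set.range f
    · rw [← Finsupp.mapDomain_comapDomain f hf e he, killCompl_monomial_mapDomain, coeff_monomial,
        coeff_monomial]
      simp only [(Finsupp.mapDomain_injective hf).eq_iff]
    · rw [killCompl_monomial_eq_zero_of_not_subset hf c he, coeff_zero, coeff_monomial, if_neg]
      rintro rfl
      exact he fun i hi => by
        obtain ⟨j, -, rfl⟩ := Finset.mem_image.1 (Finsupp.mapDomain_support hi)
        exact ⟨j, rfl⟩
  | add p q hp hq => rw [map_add, coeff_add, coeff_add, hp, hq]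

theorem killCompl_esymm [Fintype σ] (s : Finset σ) (n : ℕ) :
    killCompl (Subtype.val_injective (p := (· ∈ s))) (esymm σ R n) = esymm s R n := by
  classical
  rw [esymm, map_sum, ← Finset.sum_subset (Finset.powersetCard_mono (Finset.subset_univ s))]
  · have hs : Finset.powersetCard n s = (Finset.powersetCard n (Finset.univ : Finset s)).map
        (Finset.mapEmbedding (Function.Embedding.subtype (· ∈ s))).toEmbedding := by
      rw [← Finset.powersetCard_map, Finset.univ_eq_attach]
      exact congrArg _ Finset.attach_map_val.symm
    rw [esymm, hs, Finset.sum_map]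
    refine Finset.sum_congr rfl fun t _ => ?_
    simp [killCompl]
  · intro t ht hts
    obtain ⟨i, hi, his⟩ := Finset.not_subset.1 fun h =>
      hts (Finset.mem_powersetCard.2 ⟨h, (Finset.mem_powersetCard.1 ht).2⟩)
    rw [map_prod]
    exact Finset.prod_eq_zero hi (by simp [killCompl, his])

end ElementarySymmetric

theorem exists_algebraicIndependent_comp {ι κ R A : Type*} [CommRing R] [IsDomain R] [CommRing A]
    [Algebra R A] [Finite κ] {B : κ → Type*} [∀ k, CommRing (B k)] [∀ k, Algebra R (B k)]
    (f : ∀ k, A →ₐ[R] B k) (hf : ∀ a, (∀ k, f k a = 0) → a = 0) {b : ι → A}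
    (hb : AlgebraicIndependent R b) : ∃ k, AlgebraicIndependent R (f k ∘ b) := by
  have := Fintype.ofFinite κ
  have hprod : ∏ k, RingHom.ker (aeval (R := R) (f k ∘ b)) = ⊥ := by
    refine eq_bot_iff.2 fun p hp => ?_
    have hker : ∀ k, aeval (f k ∘ b) p = 0 := fun k =>
      (prod_le_inf.trans (Finset.inf_le (Finset.mem_univ k))) hp
    refine (Submodule.mem_bot _).2 (hb.eq_zero_of_aeval_eq_zero p (hf _ fun k => ?_))
    rw [← AlgHom.comp_apply, comp_aeval]
    exact hker k
  obtain ⟨k, -, hk⟩ := Finset.prod_eq_zero_iff.1 (hprod.trans zero_eq_bot.symm)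
  exact ⟨k, (RingHom.injective_iff_ker_eq_bot _).2 hk⟩

section Restriction

variable {V : Type*} {K : PreAbstractSimplicialComplex V} {F : Type*} [Field F] {σ : Finset V}
  {n : ℕ}

theorem mem_stanleyReisnerIdeal_iff_killCompl {p : MvPolynomial V F} :
    p ∈ K.stanleyReisnerIdeal F ↔
      ∀ σ : Finset V, K.IsFace σ → killCompl (Subtype.val_injective (p := (· ∈ σ))) p = 0 := by
  classical
  rw [mem_stanleyReisnerIdeal_iff]
  constructor
  · intro h σ hσ
    ext d
    rw [coeff_killCompl, coeff_zero]
    by_contra hd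
    refine h _ (mem_support_iff.2 hd) (isFace_mono (fun i hi => ?_) hσ)
    obtain ⟨j, -, rfl⟩ := Finset.mem_image.1 (Finsupp.mapDomain_support hi)
    exact j.2
  · intro h d hd hface
    refine mem_support_iff.1 hd ?_
    rw [← Finsupp.mapDomain_comapDomain _ (Subtype.val_injective (p := (· ∈ d.support))) d
      (fun i hi => ⟨⟨i, hi⟩, rfl⟩), ← coeff_killCompl Subtype.val_injective, h _ hface, coeff_zero]

/-- Restriction of functions to the coordinate subspace of a face, `F(K) → F[v_j : j ∈ σ]`. -/
noncomputable def restrictFace (hσ : K.IsFace σ) : K.FaceRing F →ₐ[F] MvPolynomial σ F :=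
  Ideal.Quotient.liftₐ _ (killCompl Subtype.val_injective) fun _ hp =>
    mem_stanleyReisnerIdeal_iff_killCompl.1 hp _ hσ

theorem exists_isFace_le_card [Finite V] {b : Fin n → K.FaceRing F}
    (hb : AlgebraicIndependent F b) : ∃ σ, K.IsFace σ ∧ n ≤ σ.card := by
  obtain ⟨⟨σ, hσ⟩, hind⟩ := exists_algebraicIndependent_comp
    (fun σ : {σ : Finset V // K.IsFace σ} => restrictFace (F := F) σ.2) (fun a ha => by
      obtain ⟨p, rfl⟩ := Ideal.Quotient.mk_surjective a
      exact Ideal.Quotient.eq_zero_iff_mem.2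
        (mem_stanleyReisnerIdeal_iff_killCompl.2 fun σ hσ => ha ⟨σ, hσ⟩)) hb
  have hcard := hind.lift_cardinalMk_le_trdeg
  rw [MvPolynomial.trdeg_of_isDomain] at hcard
  exact ⟨σ, hσ, by simpa using hcard⟩

variable [Fintype V]

theorem algebraicIndependent_mk_esymm (hσ : K.IsFace σ) (hn : n ≤ σ.card) :
    AlgebraicIndependent F fun i : Fin n =>
      Ideal.Quotient.mk (K.stanleyReisnerIdeal F) (esymm V F (i + 1)) := by
  refine AlgebraicIndependent.of_comp (restrictFace hσ) ?_
  have hcomp : (restrictFace hσ ∘ fun i : Fin n =>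
      Ideal.Quotient.mk (K.stanleyReisnerIdeal F) (esymm V F (i + 1))) =
      fun i : Fin n => esymm σ F (i + 1) := by
    ext1 i
    exact killCompl_esymm σ _
  rw [hcomp]
  exact algebraicIndependent_esymm (by simpa using hn)

theorem esymm_mem_stanleyReisnerIdeal (hn : ∀ σ, K.IsFace σ → σ.card < n) :
    esymm V F n ∈ K.stanleyReisnerIdeal F :=
  sum_mem _ fun t ht => subset_span ⟨t, fun hface =>
    (hn t hface).ne (Finset.mem_powersetCard.1 ht).2, rfl⟩

theorem isParameterList_esymm (hK : ∀ σ, K.IsFace σ → σ.card ≤ n) :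
    IsParameterList K (List.ofFn fun i : Fin n => esymm V F (i + 1)) where
  mem := List.forall_mem_ofFn_iff.2 fun _ => esymm_mem_idealOfVars (Nat.succ_ne_zero _)
  homogeneous := List.forall_mem_ofFn_iff.2 fun _ => ⟨_, isWeightedHomogeneous_esymm 2 _⟩
  le_radical := by
    refine span_le.2 (Set.range_subset_iff.2 fun i => ⟨Fintype.card V, ?_⟩)
    refine span_le.2 ?_ (X_pow_card_mem_span_esymm i)
    rintro _ ⟨j, rfl⟩
    obtain hj | hj := lt_or_ge j n
    · exact Submodule.mem_sup_right (subset_span (List.mem_ofFn.2 ⟨⟨j, hj⟩, rfl⟩))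
    · exact Submodule.mem_sup_left
        (esymm_mem_stanleyReisnerIdeal fun σ hσ => (hK σ hσ).trans_lt (Nat.lt_succ_of_le hj))

end Restriction

open GradedPieces

section Hsop

variable {V : Type*} {K : PreAbstractSimplicialComplex V} {F : Type*} [Field F] {r : ℕ}

theorem ofList_ofFn {R : Type*} [CommRing R] (p : Fin r → R) :
    ofList (List.ofFn p) = span (Set.range p) := by
  simp only [ofList, List.mem_ofFn, Set.range]

theorem comap_mk_span_range {R : Type*} [CommRing R] (I : Ideal R) (p : Fin r → R) :
    (span (Set.range (Ideal.Quotient.mk I ∘ p))).comap (Ideal.Quotient.mk I) =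
      I ⊔ ofList (List.ofFn p) := by
  rw [Set.range_comp, ← map_span, comap_map_of_surjective' _ Ideal.Quotient.mk_surjective, mk_ker,
    ofList_ofFn, sup_comm]

theorem isWeaklyRegular_mk_comp_iff {R : Type*} [CommRing R] {I : Ideal R} {p : Fin r → R} :
    IsWeaklyRegular (R ⧸ I) (List.ofFn (Ideal.Quotient.mk I ∘ p)) ↔
      IsWeaklyRegular (R ⧸ I) (List.ofFn p) := by
  rw [← List.map_ofFn]
  exact isWeaklyRegular_map_algebraMap_iff (R ⧸ I) (R ⧸ I) _

theorem mem_idealOfVars_of_isWeightedHomogeneous {w : V → ℕ} {p : MvPolynomial V F} {n : ℕ}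
    (hp : IsWeightedHomogeneous w p n) (hn : n ≠ 0) : p ∈ idealOfVars V F :=
  mem_idealOfVars_iff.2 (hp.coeff_eq_zero 0 (by simpa using hn.symm))

theorem mem_quotient_faceRingGrading_iff {I : Ideal (K.FaceRing F)} {n : ℕ}
    {x : K.FaceRing F ⧸ I} :
    x ∈ quotient (K.faceRingGrading F) I n ↔
      ∃ p, IsWeightedHomogeneous (fun _ : V => 2) p n ∧
        Ideal.Quotient.mk I (Ideal.Quotient.mk (K.stanleyReisnerIdeal F) p) = x := by
  constructor
  · rintro ⟨_, ⟨p, hp, rfl⟩, rfl⟩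
    exact ⟨p, hp, rfl⟩
  · rintro ⟨p, hp, rfl⟩
    exact ⟨_, ⟨p, hp, rfl⟩, rfl⟩

theorem mk_mk_eq_zero_iff {p : Fin r → MvPolynomial V F} {z : MvPolynomial V F} :
    Ideal.Quotient.mk (span (Set.range (Ideal.Quotient.mk (K.stanleyReisnerIdeal F) ∘ p)))
        (Ideal.Quotient.mk (K.stanleyReisnerIdeal F) z) = 0 ↔
      z ∈ K.stanleyReisnerIdeal F ⊔ ofList (List.ofFn p) := by
  rw [Ideal.Quotient.eq_zero_iff_mem, ← comap_mk_span_range, mem_comap]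

theorem degree_ne_zero_of_isHsop {a : Fin r → K.FaceRing F} (ha : IsHsop (K.faceRingGrading F) a)
    {p : MvPolynomial V F} {i : Fin r} {n : ℕ}
    (hpa : Ideal.Quotient.mk (K.stanleyReisnerIdeal F) p = a i)
    (hp : IsWeightedHomogeneous (fun _ : V => 2) p n) : n ≠ 0 := by
  rintro rfl
  refine ha.algebraicIndependent.transcendental i ?_
  rw [← hpa, ← hp.weightedHomogeneousComponent_same,
    weightedHomogeneousComponent_zero _ fun _ => two_ne_zero]
  exact isAlgebraic_algebraMap (A := K.FaceRing F) (coeff 0 p)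

theorem exists_isParameterList_of_isHsop {a : Fin r → K.FaceRing F}
    (ha : IsHsop (K.faceRingGrading F) a) :
    ∃ p : Fin r → MvPolynomial V F, Ideal.Quotient.mk (K.stanleyReisnerIdeal F) ∘ p = a ∧
      IsParameterList K (List.ofFn p) := by
  choose n hn using ha.homogeneous
  choose p hp hpa using hn
  have hpa' : Ideal.Quotient.mk (K.stanleyReisnerIdeal F) ∘ p = a := funext hpa
  refine ⟨p, hpa', List.forall_mem_ofFn_iff.2 fun i =>
      mem_idealOfVars_of_isWeightedHomogeneous (hp i) (degree_ne_zero_of_isHsop ha (hpa i) (hp i)),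
    List.forall_mem_ofFn_iff.2 fun i => ⟨n i, hp i⟩, span_le.2 (Set.range_subset_iff.2 fun i => ?_)⟩
  obtain ⟨⟨N, hN⟩, -⟩ := ha.finite_quotient
  refine ⟨N, ?_⟩
  rw [← mk_mk_eq_zero_iff, hpa', ← Submodule.mem_bot F, ← hN (N * 2) (by omega)]
  exact mem_quotient_faceRingGrading_iff.2
    ⟨X i ^ N, (isWeightedHomogeneous_X F (fun _ : V => 2) i).pow N, rfl⟩

theorem mem_pow_idealOfVars_of_isWeightedHomogeneous {R : Type*} [CommSemiring R] {k n N : ℕ}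
    {p : MvPolynomial V R} (hp : IsWeightedHomogeneous (fun _ => k) p n) (hn : N * k ≤ n)
    (hk : 0 < k) : p ∈ idealOfVars V R ^ N := by
  refine (mem_pow_idealOfVars_iff N p).2 fun d hd => Nat.le_of_mul_le_mul_right ?_ hk
  have hweight : Finsupp.weight (fun _ : V => k) d = d.degree * k := by
    simp only [Finsupp.weight_apply, Finsupp.degree_apply, Finsupp.sum, Finset.sum_mul, smul_eq_mul]
  rwa [← hweight, hp (mem_support_iff.1 hd)]

theorem IsParameterList.isHsop [Finite V] {p : Fin r → MvPolynomial V F}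
    (hp : IsParameterList K (List.ofFn p))
    (hind : AlgebraicIndependent F (Ideal.Quotient.mk (K.stanleyReisnerIdeal F) ∘ p)) :
    IsHsop (K.faceRingGrading F) (Ideal.Quotient.mk (K.stanleyReisnerIdeal F) ∘ p) where
  homogeneous i := by
    obtain ⟨n, hn⟩ := hp.homogeneous (p i) (List.mem_ofFn.2 ⟨i, rfl⟩)
    exact ⟨n, p i, hn, rfl⟩
  algebraicIndependent := hind
  finite_quotient := by
    constructor
    · obtain ⟨N, hN⟩ := exists_pow_le_of_le_radical_of_fg hp.le_radical (idealOfVars_fg V F)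
      refine ⟨N * 2, fun j hj => (Submodule.eq_bot_iff _).2 fun x hx => ?_⟩
      obtain ⟨q, hq, rfl⟩ := mem_quotient_faceRingGrading_iff.1 hx
      exact mk_mk_eq_zero_iff.2
        (hN (mem_pow_idealOfVars_of_isWeightedHomogeneous hq hj two_pos))
    · intro j
      have hfg := weightedHomogeneousSubmodule_fg F (fun _ : V => 2) (fun _ => two_ne_zero) j
      exact Module.Finite.iff_fg.2 ((hfg.map _).map _)

end Hsop

section Socle

variable {F : Type*} [Field F]

theorem nonempty_linearEquiv_self_iff {M : Type*} [AddCommGroup M] [Module F M] :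
    Nonempty (M ≃ₗ[F] F) ↔ ∃ u : M, u ≠ 0 ∧ ∀ z : M, ∃ c : F, c • u = z := by
  rw [← finrank_eq_one_iff']
  constructor
  · rintro ⟨e⟩
    rw [e.finrank_eq, Module.finrank_self]
  · intro h
    have := Module.finite_of_finrank_eq_succ h
    exact FiniteDimensional.nonempty_linearEquiv_of_finrank_eq
      (h.trans (Module.finrank_self F).symm)

theorem hasSimpleSocle_bot_iff {B : Type*} [CommRing B] [Algebra F B] {𝔫 : Ideal B}
    (h𝔫 : ∀ z, ∃ c, z - algebraMap F B c ∈ 𝔫) {S : Submodule F B}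
    (hS : ∀ z, z ∈ S ↔ z ∈ (⊥ : Ideal B).colon (𝔫 : Set B)) :
    HasSimpleSocle 𝔫 ⊥ ↔ Nonempty (S ≃ₗ[F] F) := by
  rw [nonempty_linearEquiv_self_iff]
  constructor
  · rintro ⟨u, hmu, hu, hgen⟩
    refine ⟨⟨u, (hS u).2 hmu⟩, fun h => hu (congrArg Subtype.val h), fun ⟨z, hz⟩ => ?_⟩
    obtain ⟨k, hk⟩ := hgen z ((hS z).1 hz)
    obtain ⟨c, hc⟩ := h𝔫 k
    refine ⟨c, Subtype.ext ?_⟩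
    have hcu : u * (k - algebraMap F B c) = 0 := Submodule.mem_colon.1 hmu _ hc
    rw [Submodule.coe_smul, Algebra.smul_def]
    linear_combination -(Submodule.mem_bot B).1 hk - hcu
  · rintro ⟨⟨u, hmu⟩, hu, hgen⟩
    refine ⟨u, (hS u).1 hmu, fun h => hu (Subtype.ext h), fun z hz => ?_⟩
    obtain ⟨c, hc⟩ := hgen ⟨z, (hS z).2 hz⟩
    refine ⟨algebraMap F B c, ?_⟩
    rw [← Algebra.smul_def, Submodule.mem_bot, sub_eq_zero]
    exact (congrArg Subtype.val hc).symm

variable {V : Type*} {K : PreAbstractSimplicialComplex V}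

theorem mem_bot_colon_map_span_iff {R B : Type*} [CommRing R] [CommRing B] (f : R →+* B)
    {s : Set R} {z : B} :
    z ∈ (⊥ : Ideal B).colon ((span s).map f : Set B) ↔ ∀ x ∈ s, f x * z = 0 := by
  rw [map_span, colon_span, Submodule.mem_colon, Set.forall_mem_image]
  simp only [Submodule.mem_bot, smul_eq_mul, mul_comm]

theorem mem_socle_iff_mem_bot_colon {B : Type*} [CommRing B] [Algebra F B] {w : V → ℕ}
    (hw : ∀ i, w i ≠ 0) {𝒜 : ℕ → Submodule F B} (f : MvPolynomial V F →+* B)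
    (h𝒜 : ∀ n x, x ∈ 𝒜 n ↔ ∃ p, IsWeightedHomogeneous w p n ∧ f p = x) (z : B) :
    z ∈ socle 𝒜 ↔ z ∈ (⊥ : Ideal B).colon ((idealOfVars V F).map f : Set B) := by
  constructor
  · refine fun h => (mem_bot_colon_map_span_iff f).2 (Set.forall_mem_range.2 fun i => ?_)
    exact h _ (Nat.pos_of_ne_zero (hw i)) _ ((h𝒜 _ _).2 ⟨X i, isWeightedHomogeneous_X F w i, rfl⟩)
  · intro h n hn c hc
    obtain ⟨q, hq, rfl⟩ := (h𝒜 _ _).1 hc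
    rw [← span_eq (idealOfVars V F)] at h
    exact (mem_bot_colon_map_span_iff f).1 h q
      (mem_idealOfVars_of_isWeightedHomogeneous hq hn.ne')

theorem nonempty_socle_quotient_equiv_iff {A : Type*} [CommRing A] [Algebra F A] {w : V → ℕ}
    (hw : ∀ i, w i ≠ 0) {𝒜 : ℕ → Submodule F A} {f : MvPolynomial V F →ₐ[F] A}
    (hf : Function.Surjective f)
    (h𝒜 : ∀ n, 𝒜 n = (weightedHomogeneousSubmodule F w n).map f.toLinearMap) {I : Ideal A} :
    Nonempty (socle (quotient 𝒜 I) ≃ₗ[F] F) ↔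
      HasSimpleSocle (idealOfVars V F) (I.comap f) := by
  set π : MvPolynomial V F →ₐ[F] A ⧸ I := (Ideal.Quotient.mkₐ F I).comp f
  have hπ : Function.Surjective π := (Ideal.Quotient.mkₐ_surjective F I).comp hf
  have hpieces (n : ℕ) (x : A ⧸ I) :
      x ∈ quotient 𝒜 I n ↔ ∃ p, IsWeightedHomogeneous w p n ∧ π p = x := by
    rw [quotient, h𝒜, ← Submodule.map_comp]
    rfl
  have hker : (⊥ : Ideal (A ⧸ I)).comap π = I.comap f := by
    ext p
    exact Ideal.Quotient.eq_zero_iff_mem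
  have hresidue (z : A ⧸ I) : ∃ c, z - algebraMap F _ c ∈ (idealOfVars V F).map π.toRingHom := by
    obtain ⟨p, rfl⟩ := hπ z
    refine ⟨constantCoeff p, ?_⟩
    rw [← π.commutes, ← map_sub]
    exact mem_map_of_mem _ (mem_idealOfVars_iff.2 (by simp))
  rw [← hasSimpleSocle_bot_iff hresidue (mem_socle_iff_mem_bot_colon hw _ hpieces),
    HasSimpleSocle.map_iff fun z => ?_, ← hker]
  · rfl
  · obtain ⟨p, rfl⟩ := hπ z
    exact ⟨p, by simp⟩

theorem nonempty_socle_equiv_iff {r : ℕ} {p : Fin r → MvPolynomial V F} :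
    Nonempty (socle (quotient (K.faceRingGrading F)
        (span (Set.range (Ideal.Quotient.mk (K.stanleyReisnerIdeal F) ∘ p)))) ≃ₗ[F] F) ↔
      HasSimpleSocle (idealOfVars V F) (K.stanleyReisnerIdeal F ⊔ ofList (List.ofFn p)) := by
  rw [← comap_mk_span_range]
  exact nonempty_socle_quotient_equiv_iff (fun _ => two_ne_zero)
    (Ideal.Quotient.mkₐ_surjective F (K.stanleyReisnerIdeal F)) fun _ => rfl

end Socle

section Links

variable {V : Type*} {K : PreAbstractSimplicialComplex V} {F : Type*} [Field F] {r : ℕ} {v : V}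

/-- The face ring has a homogeneous system of parameters of length `r` which is a regular sequence,
given by polynomials representing it. -/
def HasRegularParameters (K : PreAbstractSimplicialComplex V) (F : Type*) [Field F] (r : ℕ) :
    Prop :=
  ∃ p : Fin r → MvPolynomial V F,
    IsHsop (K.faceRingGrading F) (Ideal.Quotient.mk (K.stanleyReisnerIdeal F) ∘ p) ∧
      IsParameterList K (List.ofFn p) ∧ IsWeaklyRegular (K.FaceRing F) (List.ofFn p)

theorem isCohenMacaulay_iff :
    IsCohenMacaulay (K.faceRingGrading F) ↔ ∃ r, HasRegularParameters K F r := by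
  constructor
  · rintro ⟨r, a, ha, hreg⟩
    obtain ⟨p, rfl, hp⟩ := exists_isParameterList_of_isHsop ha
    exact ⟨r, p, ha, hp, isWeaklyRegular_mk_comp_iff.1 hreg⟩
  · rintro ⟨r, p, ha, -, hreg⟩
    exact ⟨r, _, ha, isWeaklyRegular_mk_comp_iff.2 hreg⟩

theorem link_induction [DecidableEq V] {P : PreAbstractSimplicialComplex V → Prop}
    (hP : ∀ (L : PreAbstractSimplicialComplex V) (v : V), L.IsFace {v} → P L → P (L.link {v}))
    (hK : P K) {τ : Finset V} (hτ : K.IsFace τ) : P (K.link τ) := by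
  induction τ using Finset.induction_on with
  | empty => rwa [link_empty]
  | insert v τ hv ih =>
    rw [link_insert hv hτ]
    exact hP _ v (isFace_link_singleton_of_insert hv hτ)
      (ih (isFace_mono (Finset.subset_insert v τ) hτ))

theorem maximal_isFace_link_erase [DecidableEq V] {τ : Finset V} (hτ : Maximal K.IsFace τ)
    (hv : v ∈ τ) : Maximal (K.link {v}).IsFace (τ.erase v) := by
  have hvK : K.IsFace {v} := isFace_mono (Finset.singleton_subset_iff.2 hv) hτ.prop
  refine ⟨?_, fun ρ hρ hle => ?_⟩
  · rw [isFace_link_singleton hvK, Finset.insert_erase hv]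
    exact ⟨Finset.notMem_erase v τ, hτ.prop⟩
  · rw [isFace_link_singleton hvK] at hρ
    have hsub : τ ⊆ insert v ρ := Finset.subset_insert_iff.2 hle
    exact Finset.subset_erase.2
      ⟨(Finset.subset_insert v ρ).trans (hτ.le_of_ge hρ.2 hsub), hρ.1⟩

variable [Finite V]

theorem exists_isFace_forall_card_le (K : PreAbstractSimplicialComplex V) :
    ∃ σ, K.IsFace σ ∧ ∀ τ, K.IsFace τ → τ.card ≤ σ.card :=
  Set.exists_max_image {σ | K.IsFace σ} Finset.card (Set.toFinite _) ⟨∅, isFace_empty⟩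

theorem HasRegularParameters.eq_zero_of_maximal_empty (hK : HasRegularParameters K F r)
    (hempty : Maximal K.IsFace ∅) : r = 0 := by
  obtain ⟨p, hp, -⟩ := hK
  obtain ⟨σ, hσ, hr⟩ := exists_isFace_le_card hp.algebraicIndependent
  have hσ' : σ = ∅ := Finset.subset_empty.1 (hempty.le_of_ge hσ (Finset.empty_subset σ))
  simpa [hσ'] using hr

theorem HasRegularParameters.exists_isFace_link [DecidableEq V] (hv : K.IsFace {v})
    (hK : HasRegularParameters K F r) :
    ∃ σ, (K.link {v}).IsFace σ ∧ (∀ τ, (K.link {v}).IsFace τ → τ.card ≤ σ.card) ∧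
      r = σ.card + 1 := by
  have := Fintype.ofFinite V
  obtain ⟨p, -, hp, hreg⟩ := hK
  obtain ⟨σ, hσ, hmax⟩ := exists_isFace_forall_card_le (K.link {v})
  refine ⟨σ, hσ, hmax, le_antisymm ?_ ?_⟩
  · simpa using length_le_of_link hv hp hreg (isParameterList_esymm hmax)
  · rw [isFace_link_singleton hv] at hσ
    simpa [Finset.card_insert_of_notMem hσ.1] using card_le_length hσ.2 hp

theorem HasRegularParameters.link [DecidableEq V] (hv : K.IsFace {v})
    (hK : HasRegularParameters K F (r + 1)) :
    HasRegularParameters (K.link {v}) F r := by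
  have := Fintype.ofFinite V
  obtain ⟨σ, hσ, hmax, hr⟩ := hK.exists_isFace_link hv
  obtain rfl : r = σ.card := Nat.succ_injective hr
  obtain ⟨p, -, hp, hreg⟩ := hK
  have hb := isParameterList_esymm (F := F) hmax
  exact ⟨_, hb.isHsop (algebraicIndependent_mk_esymm hσ le_rfl), hb,
    isWeaklyRegular_link hv hp hreg hb (by simp)⟩

theorem HasRegularParameters.card_eq {τ : Finset V} (hτ : Maximal K.IsFace τ)
    (hK : HasRegularParameters K F r) : τ.card = r := by
  classical
  induction hn : τ.card generalizing K r τ with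
  | zero =>
    obtain rfl := Finset.card_eq_zero.1 hn
    exact (hK.eq_zero_of_maximal_empty hτ).symm
  | succ n ih =>
    obtain ⟨v, hv⟩ := Finset.card_pos.1 (n.succ_pos.trans_eq hn.symm)
    have hvK : K.IsFace {v} := isFace_mono (Finset.singleton_subset_iff.2 hv) hτ.prop
    obtain ⟨σ, -, -, rfl⟩ := hK.exists_isFace_link hvK
    rw [ih (maximal_isFace_link_erase hτ hv) (hK.link hvK)
      (by rw [Finset.card_erase_of_mem hv, hn, Nat.add_sub_cancel])]

theorem isPure_of_isCohenMacaulay (h : IsCohenMacaulay (K.faceRingGrading F)) : K.IsPure := by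
  obtain ⟨r, hr⟩ := isCohenMacaulay_iff.1 h
  exact fun σ τ hσ hτ => (hr.card_eq hσ).trans (hr.card_eq hτ).symm

theorem isCohenMacaulay_link_singleton [DecidableEq V] (hv : K.IsFace {v})
    (h : IsCohenMacaulay (K.faceRingGrading F)) :
    IsCohenMacaulay ((K.link {v}).faceRingGrading F) := by
  rw [isCohenMacaulay_iff] at h ⊢
  obtain ⟨r, hr⟩ := h
  obtain ⟨σ, -, -, rfl⟩ := hr.exists_isFace_link hv
  exact ⟨_, hr.link hv⟩

theorem isGorenstein_link_singleton [DecidableEq V] (hv : K.IsFace {v})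
    (h : IsGorenstein (K.faceRingGrading F)) :
    IsGorenstein ((K.link {v}).faceRingGrading F) := by
  refine ⟨isCohenMacaulay_link_singleton hv h.1, fun s b hb => ?_⟩
  obtain ⟨r, hr⟩ := isCohenMacaulay_iff.1 h.1
  obtain ⟨σ, hσ, hmax, rfl⟩ := hr.exists_isFace_link hv
  obtain ⟨p, hpsop, hp, hreg⟩ := hr
  obtain ⟨q, rfl, hq⟩ := exists_isParameterList_of_isHsop hb
  have hs : s = σ.card := by
    refine le_antisymm ?_ (by simpa using card_le_length hσ hq)
    obtain ⟨τ, hτ, hsτ⟩ := exists_isFace_le_card hb.algebraicIndependent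
    exact hsτ.trans (hmax τ hτ)
  rw [nonempty_socle_equiv_iff]
  exact .link hv hp hreg hq (by simp [hs]) (nonempty_socle_equiv_iff.1 (h.2 _ _ hpsop))

end Links

end StanleyReisner

theorem corollary6p3 {F : Type*} [Field F] {V : Type*} [Finite V] [DecidableEq V]
    (K : PreAbstractSimplicialComplex V) :
    (GradedPieces.IsCohenMacaulay (K.faceRingGrading F) →
      K.IsPure ∧ ∀ τ : Finset V, K.IsFace τ →
        GradedPieces.IsCohenMacaulay ((K.link τ).faceRingGrading F)) ∧
    (GradedPieces.IsGorenstein (K.faceRingGrading F) →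
      K.IsPure ∧ ∀ τ : Finset V, K.IsFace τ →
        GradedPieces.IsGorenstein ((K.link τ).faceRingGrading F)) := by
  refine ⟨fun h => ⟨StanleyReisner.isPure_of_isCohenMacaulay h, fun τ hτ => ?_⟩,
    fun h => ⟨StanleyReisner.isPure_of_isCohenMacaulay h.1, fun τ hτ => ?_⟩⟩
  · exact StanleyReisner.link_induction
      (P := fun L => GradedPieces.IsCohenMacaulay (L.faceRingGrading F))
      (fun _ _ => StanleyReisner.isCohenMacaulay_link_singleton) h hτ
  · exact StanleyReisner.link_induction
      (P := fun L => GradedPieces.IsGorenstein (L.faceRingGrading F))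
      (fun _ _ => StanleyReisner.isGorenstein_link_singleton) h hτ
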